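/- Let $G$ be a (finite-dimensional, real, smooth) Lie group with Lie algebra $\mathfrak g=T_eG$ and dual space $\mathfrak g^*$. For $g\in G$, $\eta\in\mathfrak g$, $\xi\in\mathfrak g^*$ put $\langle \mathrm{Ad}^*g\cdot\xi,\eta\rangle=\langle\xi,\mathrm{Ad}\,g\cdot\eta\rangle$. Fix $\zeta\in\mathfrak g$, let $G^{[\zeta]}=\{h\in G:\mathrm{Ad}\,h\cdot\zeta=\zeta\}$, and let $\mathfrak g_\zeta=\{\mathrm{Ad}\,g\cdot\zeta: g\in G\}$ be the adjoint orbit, with its smooth structure as the homogeneous space $G/G^{[\zeta]}$; its tangent space at $a$ is $T_a\mathfrak g_\zeta=\{[a,\eta]:\eta\in\mathfrak g\}$. For $\nu\in T_a^*\mathfrak g_\zeta$ define $\mathrm{ad}^*a\cdot\nu\in\mathfrak g^*$ by $\langle \mathrm{ad}^*a\cdot\nu,\eta\rangle=\langle\nu,[a,\eta]\rangle$. Let $\nabla_af\in T^*_a\mathfrak g_\zeta$ and $\nabla_mf\in\mathfrak g$ denote the differentials of a function $f$ with respect to $a\in\mathfrak g_\zeta$ and $m\in\mathfrak g^*$ (they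 exist and are unique wherever $f$ is differentiable), and for a function $f$ on $G$ let $\langle d_wf(w),\eta\rangle=\frac{d}{d\epsilon}f(e^{\epsilon\eta}w)|_{\epsilon=0}$. On $\mathfrak g_\zeta\times\mathfrak g^*$ consider the bracket $$\{F_1,F_2\}=\langle\nabla_aF_1,[a,\nabla_mF_2]\rangle-\langle\nabla_aF_2,[a,\nabla_mF_1]\rangle-\langle m,[\nabla_mF_1,\nabla_mF_2]\rangle .\qquad (1)$$ Let $\mathbb L:G\times G\to\mathbb R$ be smooth, $\mathbb L^{(r)}(g,w)=\mathbb L(g,wg)$, and suppose $\mathbb L^{(r)}(gh,w)=\mathbb L^{(r)}(g,w)$ for all $g,w\in G$, $h\in G^{[\zeta]}$. Then $\Lambda^{(r)}(a,w)=\mathbb L^{(r)}(g,w)$, where $a=\mathrm{Ad}\,g\cdot\zeta$, is a well-defined function on $\mathfrak g_\zeta\times G$, and the following holds. **1. Reduced equations.** Let $k_0,k_1\in\mathbb Z$. A sequence $(g_k)_{k_0\le k\le k_1}$ in $G$ is an extremal of $\sum_{k_0\le k<k_1}\mathbb L(g_k,g_{k+1})$ (under variations preserving $g_{k_0}$ and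 $g_{k_1}$) if and only if $a_k=\mathrm{Ad}\,g_k\cdot\zeta$, $w_k=g_{k+1}g_k^{-1}$ satisfy $$\mathrm{Ad}^*w_k\cdot m_{k+1}=m_k-\mathrm{ad}^*a_k\cdot\nabla_a\Lambda^{(r)}(a_k,w_k)\ \ (k_0<k<k_1),\qquad a_{k+1}=\mathrm{Ad}\,w_k\cdot a_k\ \ (k_0\le k<k_1),\qquad (2)$$ where $m_k=d_w\Lambda^{(r)}(a_{k-1},w_{k-1})\in\mathfrak g^*$. Every solution $(a_k,w_k)$ of (2) in $\mathfrak g_\zeta\times G$ arises in this way from an extremal. **2. Poisson property.** Let $U\subset\mathfrak g_\zeta\times G$ be an open set (for instance all of $\mathfrak g_\zeta\times G$) on which the Legendre transformation $$(a,w)\mapsto(a',m')=(\mathrm{Ad}\,w\cdot a,\ d_w\Lambda^{(r)}(a,w))\in\mathfrak g_\zeta\times\mathfrak g^*$$ is invertible, i.e. which it maps bijectively, with smooth inverse, onto an open set $U'\subset\mathfrak g_\zeta\times\mathfrak g^*$. Consider the correspondence $(a,m)\mapsto(a',m')$ defined by (2): there is $w$ with $(a,w)\in U$, $a'=\mathrm{Ad}\,w\cdot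 a$, $m'=d_w\Lambda^{(r)}(a,w)$ and $\mathrm{Ad}^*w\cdot m'=m-\mathrm{ad}^*a\cdot\nabla_a\Lambda^{(r)}(a,w)$. - Each $(a',m')\in U'$ corresponds to exactly one $(a,m)$, and the resulting map $(a',m')\mapsto(a,m)$ from $U'$ to $\mathfrak g_\zeta\times\mathfrak g^*$ is smooth and Poisson with respect to (1). - The correspondence is locally a map: if $(a,m)\mapsto(a',m')$ through $w$ with $(a,w)\in U$, then there is an open $V\subset U$, on which the Legendre transformation is again invertible, such that the correspondence defined with $V$ in place of $U$ still relates $(a,m)$ to $(a',m')$ and is single-valued. - Whenever the correspondence is single-valued (in particular for each such $V$), its domain in $\mathfrak g_\zeta\times\mathfrak g^*$ is open, and it is a smooth map $(a_k,m_k)\mapsto(a_{k+1},m_{k+1})$ on that domain, Poisson with respect to (1). **3. Integral and Casimir.** Along every solution of (2), $\langle m_{k+1},a_{k+1}\rangle=\langle m_k,a_k\rangle$ for $k_0<k<k_1$; likewise $\langle m',a'\rangle=\langle m,a\rangle$ whenever $(a,m)$ and $(a',m')$ are related by the correspondence with $U=\mathfrak g_\zeta\times G$. The function $c(a,m)=\langle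 m,a\rangle$ is a Casimir of (1): it is smooth and $\{c,F\}=0$ for every smooth $F$ on $\mathfrak g_\zeta\times\mathfrak g^*$. -/

import Mathlib

open scoped Manifold ContDiff

noncomputable section

/-- A finite-dimensional real normed space is complete. -/
instance completeSpaceOfFiniteDimensionalReal (E : Type*) [NormedAddCommGroup E]
    [NormedSpace ℝ E] [FiniteDimensional ℝ E] : CompleteSpace E :=
  FiniteDimensional.complete ℝ E

/-- A smooth real Lie group has the regularity that Mathlib asks for in order to put a Lie algebra
structure on its tangent space at the identity. -/
instance lieGroupMinSmoothnessThree (E : Type*) [NormedAddCommGroup E] [NormedSpace ℝ E]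
    (G : Type*) [TopologicalSpace G] [ChartedSpace E G] [Group G] [LieGroup 𝓘(ℝ, E) ∞ G] :
    LieGroup 𝓘(ℝ, E) (minSmoothness ℝ 3) G := by
  rw [minSmoothness_of_isRCLikeNormedField]
  infer_instance

namespace DiscreteLagrange

section Group

variable {E : Type*} [NormedAddCommGroup E] [NormedSpace ℝ E]
  {G : Type*} [TopologicalSpace G] [ChartedSpace E G] [Group G]

/-- The Lie algebra `𝔤 = T_e G`. -/
abbrev Lie (E : Type*) [NormedAddCommGroup E] [NormedSpace ℝ E]
    (G : Type*) [TopologicalSpace G] [ChartedSpace E G] [Group G] : Type _ :=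
  GroupLieAlgebra 𝓘(ℝ, E) G

/-- The dual space `𝔤*`, with its standard structure of a finite-dimensional normed space. The
space underlying `𝔤 = T_e G` is the model space `E`, so an element of `𝔤*` is applied to elements
of `𝔤`. -/
abbrev LieDual (E : Type*) [NormedAddCommGroup E] [NormedSpace ℝ E] : Type _ :=
  E →L[ℝ] ℝ

/-- The adjoint action `Ad g : 𝔤 → 𝔤`, the differential at `e` of `h ↦ g h g⁻¹`. -/
def Ad (g : G) : Lie E G →L[ℝ] Lie E G :=
  mfderiv 𝓘(ℝ, E) 𝓘(ℝ, E) (fun h : G => g * h * g⁻¹) 1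

/-- The coadjoint operator `Ad* g : 𝔤* → 𝔤*`, `⟨Ad* g · ξ, η⟩ = ⟨ξ, Ad g · η⟩`. -/
def coAd (g : G) (ξ : LieDual E) : LieDual E :=
  ξ.comp (Ad g : Lie E G →L[ℝ] Lie E G)

/-- The Lie derivative `df(g) ∈ 𝔤*`, `⟨df(g), η⟩ = d/dε f(e^{εη} g)` at `ε = 0`: the differential
at `e` of `h ↦ f (h g)`. -/
def lieDeriv (f : G → ℝ) (g : G) : LieDual E :=
  mfderiv 𝓘(ℝ, E) 𝓘(ℝ, ℝ) (fun h : G => f (h * g)) 1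

end Group

section Adjoint

variable {E : Type*} [NormedAddCommGroup E] [NormedSpace ℝ E]
  {G : Type*} [TopologicalSpace G] [ChartedSpace E G] [Group G] [LieGroup 𝓘(ℝ, E) ∞ G]

/-- `Ad` is an action: `Ad (g h) = Ad g ∘ Ad h`. -/
theorem Ad_mul (g h : G) (ξ : Lie E G) : Ad (g * h) ξ = Ad g (Ad h ξ) := by
  have key : ∀ (k x : G), MDifferentiableAt 𝓘(ℝ, E) 𝓘(ℝ, E) (fun y : G => k * y * k⁻¹) x := by
    intro k x
    have h1 : ContMDiff 𝓘(ℝ, E) 𝓘(ℝ, E) ∞ (fun y : G => k * y * k⁻¹) :=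
      (contMDiff_const.mul contMDiff_id).mul contMDiff_const
    exact (h1 x).mdifferentiableAt (by simp)
  have e : (fun y : G => g * h * y * (g * h)⁻¹)
      = (fun y : G => g * y * g⁻¹) ∘ (fun y : G => h * y * h⁻¹) := by
    funext y; simp [mul_assoc]
  have hc := mfderiv_comp (I := 𝓘(ℝ, E)) (I' := 𝓘(ℝ, E)) (I'' := 𝓘(ℝ, E)) (1 : G)
    (key g (h * 1 * h⁻¹)) (key h 1)
  have h1 : h * 1 * h⁻¹ = 1 := by simp
  unfold Ad
  rw [e, hc]
  change mfderiv 𝓘(ℝ, E) 𝓘(ℝ, E) (fun y : G => g * y * g⁻¹) (h * 1 * h⁻¹) _ = _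
  have h2 : ∀ x : G, x = 1 → ∀ v : E,
      (mfderiv 𝓘(ℝ, E) 𝓘(ℝ, E) (fun y : G => g * y * g⁻¹) x : E →L[ℝ] E) v
      = (mfderiv 𝓘(ℝ, E) 𝓘(ℝ, E) (fun y : G => g * y * g⁻¹) 1 : E →L[ℝ] E) v := by
    rintro x rfl v; rfl
  exact h2 _ h1 _

/-- The adjoint orbit `𝔤_ζ = {Ad g · ζ : g ∈ G} ⊂ 𝔤`. -/
def adOrbit (ζ : Lie E G) : Set (Lie E G) :=
  Set.range fun g : G => Ad g ζ

/-- The isotropy subgroup `G^[ζ] = {h : Ad h · ζ = ζ}`, as a set. -/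
def isotropy (ζ : Lie E G) : Set G :=
  {h : G | Ad h ζ = ζ}

/-- The projection `G → 𝔤_ζ`, `g ↦ Ad g · ζ`. -/
def toOrbit (ζ : Lie E G) (g : G) : adOrbit ζ :=
  ⟨Ad g ζ, g, rfl⟩

/-- The adjoint action of `h ∈ G` on the orbit `𝔤_ζ`. -/
def adAct {ζ : Lie E G} (h : G) (a : adOrbit ζ) : adOrbit ζ :=
  ⟨Ad h (a : Lie E G), by
    obtain ⟨g, hg⟩ := a.2
    exact ⟨h * g, by rw [← hg]; exact Ad_mul h g ζ⟩⟩

/-!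
The orbit `𝔤_ζ` carries the topology and the smooth structure of the homogeneous space
`G / G^[ζ]`, for which `g ↦ Ad g · ζ` is a smooth open submersion. Hence a set or a function on
`𝔤_ζ × X` is open or smooth if and only if its pull-back to `G × X` is. (The orbit may be a merely
immersed submanifold of `𝔤`, so this can be finer than the subspace topology, which is not used.)
-/

section Smooth

variable (F : Type*) [NormedAddCommGroup F] [NormedSpace ℝ F]
  {X : Type*} [TopologicalSpace X] [ChartedSpace F X]
  (F' : Type*) [NormedAddCommGroup F'] [NormedSpace ℝ F']
  {Y : Type*} [TopologicalSpace Y] [ChartedSpace F' Y]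

/-- The preimage of `U ⊂ 𝔤_ζ × X` in `G × X`. -/
def orbitPreimage {ζ : Lie E G} {X : Type*} (U : Set (adOrbit ζ × X)) : Set (G × X) :=
  {q | (toOrbit ζ q.1, q.2) ∈ U}

/-- `U` is an open subset of the manifold `𝔤_ζ × X`. -/
def OrbitOpen {ζ : Lie E G} {X : Type*} [TopologicalSpace X] (U : Set (adOrbit ζ × X)) : Prop :=
  IsOpen (orbitPreimage U)

/-- `f` is a smooth function on the (open) subset `U` of the manifold `𝔤_ζ × X`,
where `X` is modelled on `F`. -/
def OrbitSmoothOn {ζ : Lie E G} (f : adOrbit ζ × X → ℝ) (U : Set (adOrbit ζ × X)) : Prop :=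
  ContMDiffOn (𝓘(ℝ, E).prod 𝓘(ℝ, F)) 𝓘(ℝ, ℝ) ∞
    (fun q : G × X => f (toOrbit ζ q.1, q.2)) (orbitPreimage U)

/-- `Ψ` is a smooth map from the (open) subset `U` of `𝔤_ζ × X` to `𝔤_ζ × Y`: it pulls smooth
functions back to smooth functions. -/
def OrbitSmoothMapOn {ζ : Lie E G} (Ψ : adOrbit ζ × X → adOrbit ζ × Y)
    (U : Set (adOrbit ζ × X)) : Prop :=
  ∀ f : adOrbit ζ × Y → ℝ, OrbitSmoothOn F' f Set.univ → OrbitSmoothOn F (fun x => f (Ψ x)) U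

end Smooth

end Adjoint

section Bracket

variable {E : Type*} [NormedAddCommGroup E] [NormedSpace ℝ E] [FiniteDimensional ℝ E]
  {G : Type*} [TopologicalSpace G] [ChartedSpace E G] [Group G] [LieGroup 𝓘(ℝ, E) ∞ G]
  {ζ : Lie E G}

/-- The operator `ad a : 𝔤 → 𝔤`, `η ↦ [a, η]`. -/
def adMap (a : Lie E G) : Lie E G →ₗ[ℝ] Lie E G :=
  LieAlgebra.ad ℝ (Lie E G) a

/-- The tangent space `T_a 𝔤_ζ = {[a, η] : η ∈ 𝔤}` of the orbit, as a subspace of `𝔤`. -/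
abbrev orbitTangent (a : adOrbit ζ) : Submodule ℝ (Lie E G) :=
  LinearMap.range (adMap (a : Lie E G))

/-- The covector `ν ∈ T*_a 𝔤_ζ` is the gradient at `a` of the function `f` on `𝔤_ζ`. For `η ∈ 𝔤`
the tangent vector at `ε = 0` of the curve `Ad e^{εη} · a` in the orbit is `[η, a] = ad a · (-η)`, so
the condition is `⟨ν, [η, a]⟩ = d/dε f(Ad e^{εη} · a)` at `ε = 0`. -/
def HasOrbitGradient (f : adOrbit ζ → ℝ) (a : adOrbit ζ)
    (ν : orbitTangent a →ₗ[ℝ] ℝ) : Prop :=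
  ∀ η : Lie E G, ν ((adMap (a : Lie E G)).rangeRestrict (-η)) =
    (mfderiv 𝓘(ℝ, E) 𝓘(ℝ, ℝ) (fun h : G => f (adAct h a)) 1 : E →L[ℝ] ℝ) η

open Classical in
/-- The gradient `∇_a f ∈ T*_a 𝔤_ζ` (it is `0` by convention where there is none). -/
def orbitGradient (f : adOrbit ζ → ℝ) (a : adOrbit ζ) : orbitTangent a →ₗ[ℝ] ℝ :=
  if h : ∃ ν, HasOrbitGradient f a ν then h.choose else 0

/-- `ad* a · ν ∈ 𝔤*` for a covector `ν ∈ T*_a 𝔤_ζ`: `⟨ad* a · ν, η⟩ = ⟨ν, [a, η]⟩`. -/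
def coad (a : adOrbit ζ) (ν : orbitTangent a →ₗ[ℝ] ℝ) : LieDual E :=
  LinearMap.toContinuousLinearMap
    (ν.comp (adMap (a : Lie E G)).rangeRestrict : E →ₗ[ℝ] ℝ)

/-- The gradient `∇_m f ∈ 𝔤** = 𝔤` of a function on the vector space `𝔤*`: the element of `𝔤`
with `⟨μ, ∇_m f⟩ = d/dε f(m + ε μ)` at `ε = 0` for all `μ ∈ 𝔤*`. -/
def dualGradient (f : LieDual E → ℝ) (m : LieDual E) : E :=
  (Module.evalEquiv ℝ E).symm
    ((fderiv ℝ f m).toLinearMap ∘ₗ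
      (LinearMap.toContinuousLinearMap : (E →ₗ[ℝ] ℝ) ≃ₗ[ℝ] (E →L[ℝ] ℝ)).toLinearMap)

theorem apply_dualGradient (f : LieDual E → ℝ) (m μ : LieDual E) :
    μ (dualGradient f m) = fderiv ℝ f m μ := by
  have h := Module.apply_evalEquiv_symm_apply ℝ E (μ : E →ₗ[ℝ] ℝ)
    ((fderiv ℝ f m).toLinearMap ∘ₗ
      (LinearMap.toContinuousLinearMap : (E →ₗ[ℝ] ℝ) ≃ₗ[ℝ] (E →L[ℝ] ℝ)).toLinearMap)
  exact h

/-- The Poisson bracket on `𝔤_ζ × 𝔤*`: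
`{f₁, f₂} = ⟨∇_a f₁, [a, ∇_m f₂]⟩ - ⟨∇_a f₂, [a, ∇_m f₁]⟩ - ⟨m, [∇_m f₁, ∇_m f₂]⟩`. -/
def poissonBracket (f₁ f₂ : adOrbit ζ × LieDual E → ℝ) (p : adOrbit ζ × LieDual E) : ℝ :=
  let ξ₁ : E := dualGradient (fun m => f₁ (p.1, m)) p.2
  let ξ₂ : E := dualGradient (fun m => f₂ (p.1, m)) p.2
  coad p.1 (orbitGradient (fun a => f₁ (a, p.2)) p.1) ξ₂
    - coad p.1 (orbitGradient (fun a => f₂ (a, p.2)) p.1) ξ₁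
    - p.2 (adMap (E := E) (G := G) ξ₁ ξ₂)

/-- `Φ` is a smooth Poisson map from the (open) subset `D` of `𝔤_ζ × 𝔤*` to `𝔤_ζ × 𝔤*`. -/
def IsPoissonMapOn (Φ : adOrbit ζ × LieDual E → adOrbit ζ × LieDual E)
    (D : Set (adOrbit ζ × LieDual E)) : Prop :=
  OrbitSmoothMapOn (LieDual E) (LieDual E) Φ D ∧
  ∀ f₁ f₂ : adOrbit ζ × LieDual E → ℝ,
    OrbitSmoothOn (LieDual E) f₁ Set.univ → OrbitSmoothOn (LieDual E) f₂ Set.univ → ∀ p ∈ D,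
      poissonBracket (fun q => f₁ (Φ q)) (fun q => f₂ (Φ q)) p = poissonBracket f₁ f₂ (Φ p)

/-- `c` is a Casimir function of the bracket. -/
def IsCasimir (c : adOrbit ζ × LieDual E → ℝ) : Prop :=
  OrbitSmoothOn (LieDual E) c Set.univ ∧
  ∀ f : adOrbit ζ × LieDual E → ℝ, OrbitSmoothOn (LieDual E) f Set.univ →
    ∀ p, poissonBracket c f p = 0

end Bracket

section Lagrangian

variable {E : Type*} [NormedAddCommGroup E] [NormedSpace ℝ E] [FiniteDimensional ℝ E]
  {G : Type*} [TopologicalSpace G] [ChartedSpace E G] [Group G] [LieGroup 𝓘(ℝ, E) ∞ G]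
  {ζ : Lie E G}

/-- The discrete action functional `∑_{k₀ ≤ k < k₁} L(g_k, g_{k+1})`. -/
def discreteAction {G : Type*} (L : G → G → ℝ) (k₀ k₁ : ℤ) (g : ℤ → G) : ℝ :=
  ∑ k ∈ Finset.Ico k₀ k₁, L (g k) (g (k + 1))

/-- The sequence `g_{k₀}, …, g_{k₁}` is an extremal of the discrete action: the action is
stationary under all variations that preserve `g_{k₀}` and `g_{k₁}`. -/
def IsExtremal {E : Type*} [NormedAddCommGroup E] [NormedSpace ℝ E]
    {G : Type*} [TopologicalSpace G] [ChartedSpace E G]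
    (L : G → G → ℝ) (k₀ k₁ : ℤ) (g : ℤ → G) : Prop :=
  ∀ γ : ℝ → ℤ → G, γ 0 = g →
    (∀ k, ContMDiffAt 𝓘(ℝ, ℝ) 𝓘(ℝ, E) ∞ (fun ε => γ ε k) 0) →
    (∀ ε, γ ε k₀ = g k₀ ∧ γ ε k₁ = g k₁) →
    HasDerivAt (fun ε => discreteAction L k₀ k₁ (γ ε)) 0 0

/-- The Lagrange function in the right trivialization: `L⁽ʳ⁾(g, w) = L(g, w g)`. -/
def rightTrivialization {G : Type*} [Mul G] (L : G → G → ℝ) (g w : G) : ℝ :=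
  L g (w * g)

/-- The reduced Lagrange function `Λ⁽ʳ⁾ : 𝔤_ζ × G → ℝ`, `Λ⁽ʳ⁾(a, w) = L⁽ʳ⁾(g, w)` where
`a = Ad g · ζ`; the choice of `g` is irrelevant for a right `G^[ζ]`-invariant `L⁽ʳ⁾`. -/
def reducedLagrangian (ζ : Lie E G) (Lr : G → G → ℝ) (x : adOrbit ζ × G) : ℝ :=
  Lr (Classical.choose x.1.2) x.2

/-- The Legendre transformation `(a, w) ↦ (Ad w · a, d_w Λ(a, w))`, from `𝔤_ζ × G` to
`𝔤_ζ × 𝔤*`. -/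
def legendre (Λ : adOrbit ζ × G → ℝ) (x : adOrbit ζ × G) : adOrbit ζ × LieDual E :=
  (adAct x.2 x.1, lieDeriv (fun w => Λ (x.1, w)) x.2)

/-- The momenta `m_k = d_w Λ(a_{k-1}, w_{k-1})`. -/
def momentum (Λ : adOrbit ζ × G → ℝ) (a : ℤ → adOrbit ζ) (w : ℤ → G) (k : ℤ) : LieDual E :=
  lieDeriv (fun v => Λ (a (k - 1), v)) (w (k - 1))

/-- The first reduced equation `Ad* w · m' = m - ad* a · ∇_a Λ(a, w)`. -/
def MomentumEquation (Λ : adOrbit ζ × G → ℝ) (a : adOrbit ζ) (w : G) (m m' : LieDual E) : Prop :=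
  coAd w m' = m - coad a (orbitGradient (fun b => Λ (b, w)) a)

/-- The pairs `(a_k, w_k)`, `k₀ ≤ k < k₁` (with `a_{k₁}`), satisfy the reduced equations. -/
def SolvesReduced (Λ : adOrbit ζ × G → ℝ) (k₀ k₁ : ℤ) (a : ℤ → adOrbit ζ) (w : ℤ → G) : Prop :=
  (∀ k, k₀ < k → k < k₁ →
    MomentumEquation Λ (a k) (w k) (momentum Λ a w k) (momentum Λ a w (k + 1))) ∧
  ∀ k, k₀ ≤ k → k < k₁ → a (k + 1) = adAct (w k) (a k)

/-- The relation that the reduced equations define between `p = (a_k, m_k)` and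
`p' = (a_{k+1}, m_{k+1})`, where the pair `(a_k, w_k)` is taken from the set `U`. -/
def Step (Λ : adOrbit ζ × G → ℝ) (U : Set (adOrbit ζ × G)) (p p' : adOrbit ζ × LieDual E) : Prop :=
  ∃ w : G, (p.1, w) ∈ U ∧ p' = legendre Λ (p.1, w) ∧ MomentumEquation Λ p.1 w p.2 p'.2

/-- The Legendre transformation is invertible on the open set `U ⊂ 𝔤_ζ × G`: it maps `U`
bijectively onto an open subset of `𝔤_ζ × 𝔤*`, with a smooth inverse. -/
def LegendreInvertibleOn (Λ : adOrbit ζ × G → ℝ) (U : Set (adOrbit ζ × G)) : Prop :=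
  OrbitOpen U ∧ OrbitOpen (legendre Λ '' U) ∧
  ∃ κ : adOrbit ζ × LieDual E → adOrbit ζ × G,
    OrbitSmoothMapOn (LieDual E) E κ (legendre Λ '' U) ∧ ∀ x ∈ U, κ (legendre Λ x) = x

end Lagrangian

end DiscreteLagrange

end

/-! Smoothness, openness and gradients on the orbit are all tested after pulling back along `g ↦ Ad
g · ζ`, so the argument takes place upstairs, on `G × 𝔤*`, which is `T*G` in the right
trivialization. No chart of the orbit is ever needed.

The reduced equations lift as follows. Since `Λ(a, w) = L(g, wg)`, the derivative in `w` is the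
derivative `d₂L(g, g')` at `g' = wg`, while moving `g` with `w` fixed also moves `g'`, through `Ad
w`. Hence `ad* a · ∇_a Λ = -(d₁L + Ad* w · d₂L)`, and the momentum equation collapses to `m =
-d₁L(g, g')`. Together with `m' = d₂L(g, g')` this turns the reduced equations into the discrete
Euler-Lagrange equations `d₂L(g_{k-1}, g_k) + d₁L(g_k, g_{k+1}) = 0` (`momentumEquation_iff`,
`isExtremal_iff`, `step_toOrbit_iff`).

For the Poisson property, `L` is a generating function. The maps `A : (g, g') ↦ (g', d₂L)` and `B :
(g, g') ↦ (g, -d₁L)` pull the canonical one-form back to forms that differ by `dL`, so they pull the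
symplectic form back to the same two-form (`symplForm_legendreChart_eq`). Invertibility of the
reduced Legendre transformation makes the differential of `A` bijective
(`injective_fderiv_legendreChart`), and nondegeneracy transfers this to `B`
(`surjective_of_symplForm_eq`). The bracket (1) is computed by Hamiltonian vectors of the functions
pulled back to `G × 𝔤*` (`exists_poissonBracket_eq`), so linear algebra at a single step gives the
equality of brackets at its two ends (`poissonBracket_eq_of_step`). The inverse function theorem for
`B` supplies the local forward map, its smoothness and its open domain.

The pairing `⟨m, a⟩` is conserved and is a Casimir because `[a, a] = 0`. -/

noncomputable section

open scoped Topology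
open Filter

namespace DiscreteLagrange

/-! ### Right translates of one chart at the identity. -/

section Chart

variable {E : Type*} [NormedAddCommGroup E] [NormedSpace ℝ E]
  {G : Type*} [TopologicalSpace G] [ChartedSpace E G] [Group G]

variable (E G) in
/-- The coordinate of the identity in the preferred chart. -/
def origin : E := extChartAt 𝓘(ℝ, E) (1 : G) 1

/-- The preferred chart at the identity, right translated to `g`. -/
def rightChart (g h : G) : E := extChartAt 𝓘(ℝ, E) (1 : G) (h * g⁻¹)

/-- The inverse of the right translated chart. -/
def rightParam (g : G) (x : E) : G := (extChartAt 𝓘(ℝ, E) (1 : G)).symm x * g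

theorem rightParam_origin (g : G) : rightParam g (origin E G) = g := by
  simp [rightParam, origin]

theorem rightChart_self (g : G) : rightChart g g = origin E G := by
  simp [rightChart, origin]

theorem target_mem_nhds_origin :
    (extChartAt 𝓘(ℝ, E) (1 : G)).target ∈ 𝓝 (origin E G) :=
  extChartAt_target_mem_nhds (I := 𝓘(ℝ, E)) (1 : G)

theorem rightChart_rightParam_of_mem {g : G} {x : E}
    (hx : x ∈ (extChartAt 𝓘(ℝ, E) (1 : G)).target) : rightChart g (rightParam g x) = x := by
  simp only [rightChart, rightParam, mul_inv_cancel_right]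
  exact (extChartAt 𝓘(ℝ, E) (1 : G)).right_inv hx

theorem rightChart_rightParam (g : G) :
    ∀ᶠ x in 𝓝 (origin E G), rightChart g (rightParam g x) = x := by
  filter_upwards [target_mem_nhds_origin (E := E) (G := G)] with x hx
  exact rightChart_rightParam_of_mem hx

/-- The chart expression of the multiplication. -/
def chartMul (G : Type*) [TopologicalSpace G] [ChartedSpace E G] [Group G] (p : E × E) : E :=
  extChartAt 𝓘(ℝ, E) (1 : G)
    ((extChartAt 𝓘(ℝ, E) (1 : G)).symm p.1 * (extChartAt 𝓘(ℝ, E) (1 : G)).symm p.2)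

theorem symm_origin : (extChartAt 𝓘(ℝ, E) (1 : G)).symm (origin E G) = 1 := by
  simp [origin]

theorem chartMul_origin_left :
    ∀ᶠ y in 𝓝 (origin E G), chartMul G (origin E G, y) = y := by
  filter_upwards [target_mem_nhds_origin (E := E) (G := G)] with x hx
  simp only [chartMul, symm_origin, one_mul]
  exact (extChartAt 𝓘(ℝ, E) (1 : G)).right_inv hx

theorem chartMul_origin_right :
    ∀ᶠ y in 𝓝 (origin E G), chartMul G (y, origin E G) = y := by
  filter_upwards [target_mem_nhds_origin (E := E) (G := G)] with x hx
  simp only [chartMul, symm_origin, mul_one]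
  exact (extChartAt 𝓘(ℝ, E) (1 : G)).right_inv hx

variable [LieGroup 𝓘(ℝ, E) ∞ G]

theorem contMDiffAt_rightChart (g : G) :
    ContMDiffAt 𝓘(ℝ, E) 𝓘(ℝ, E) ∞ (rightChart g : G → E) g := by
  have h1 : ContMDiffAt 𝓘(ℝ, E) 𝓘(ℝ, E) ∞ (extChartAt 𝓘(ℝ, E) (1 : G)) (g * g⁻¹) := by
    rw [mul_inv_cancel]; exact contMDiffAt_extChartAt
  have h2 : ContMDiffAt 𝓘(ℝ, E) 𝓘(ℝ, E) ∞ (fun h : G => h * g⁻¹) g :=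
    contMDiffAt_id.mul contMDiffAt_const
  exact h1.comp g h2

theorem contMDiffAt_symm_of_mem {x : E} (hx : x ∈ (extChartAt 𝓘(ℝ, E) (1 : G)).target) :
    ContMDiffAt 𝓘(ℝ, E) 𝓘(ℝ, E) ∞ (extChartAt 𝓘(ℝ, E) (1 : G)).symm x :=
  (contMDiffOn_extChartAt_symm (1 : G)).contMDiffAt
    ((isOpen_extChartAt_target (I := 𝓘(ℝ, E)) (1 : G)).mem_nhds hx)

theorem contMDiffAt_symm_origin :
    ContMDiffAt 𝓘(ℝ, E) 𝓘(ℝ, E) ∞ (extChartAt 𝓘(ℝ, E) (1 : G)).symm (origin E G) :=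
  contMDiffAt_symm_of_mem (mem_of_mem_nhds target_mem_nhds_origin)

theorem contMDiffAt_rightParam (g : G) :
    ContMDiffAt 𝓘(ℝ, E) 𝓘(ℝ, E) ∞ (rightParam g : E → G) (origin E G) :=
  contMDiffAt_symm_origin.mul contMDiffAt_const

theorem tendsto_rightParam (g : G) :
    Tendsto (rightParam g : E → G) (𝓝 (origin E G)) (𝓝 g) := by
  have h := (contMDiffAt_rightParam (E := E) g).continuousAt.tendsto
  rwa [rightParam_origin] at h

theorem tendsto_rightChart (g : G) :
    Tendsto (rightChart g : G → E) (𝓝 g) (𝓝 (origin E G)) := by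
  have h := (contMDiffAt_rightChart (E := E) g).continuousAt.tendsto
  rwa [rightChart_self] at h

theorem eventually_mem_source_mul_inv (g : G) :
    ∀ᶠ h in 𝓝 g, h * g⁻¹ ∈ (extChartAt 𝓘(ℝ, E) (1 : G)).source := by
  have h2 : ContMDiff 𝓘(ℝ, E) 𝓘(ℝ, E) ∞ (fun h : G => h * g⁻¹) :=
    contMDiff_id.mul contMDiff_const
  refine h2.continuous.continuousAt.tendsto.eventually ?_
  simp only [mul_inv_cancel]
  exact extChartAt_source_mem_nhds (I := 𝓘(ℝ, E)) (1 : G)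

theorem rightParam_rightChart (g : G) :
    ∀ᶠ h in 𝓝 g, rightParam g (rightChart g h : E) = h := by
  filter_upwards [eventually_mem_source_mul_inv (E := E) g] with h hh
  simp only [rightParam, rightChart]
  rw [(extChartAt 𝓘(ℝ, E) (1 : G)).left_inv hh, inv_mul_cancel_right]

/-- Equality, not just convergence, is what lets a property checked in the chart be asserted on a
neighbourhood of `g`. -/
theorem map_rightParam_nhds (g : G) : map (rightParam g : E → G) (𝓝 (origin E G)) = 𝓝 g := by
  refine le_antisymm (tendsto_rightParam g) ?_
  intro s hs
  have h1 := (tendsto_rightChart (E := E) g).eventually hs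
  filter_upwards [h1, rightParam_rightChart (E := E) g] with h ha hb
  rw [← hb]; exact ha

theorem contDiffAt_chartMul :
    ContDiffAt ℝ ∞ (chartMul G : E × E → E) (origin E G, origin E G) := by
  rw [← contMDiffAt_iff_contDiffAt]
  have h0 : ContMDiffAt 𝓘(ℝ, E) 𝓘(ℝ, E) ∞ (extChartAt 𝓘(ℝ, E) (1 : G))
      ((extChartAt 𝓘(ℝ, E) (1 : G)).symm (origin E G) *
        (extChartAt 𝓘(ℝ, E) (1 : G)).symm (origin E G)) := by
    rw [symm_origin, one_mul]; exact contMDiffAt_extChartAt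
  have h1 : ContMDiffAt 𝓘(ℝ, E × E) 𝓘(ℝ, E) ∞
      (fun p : E × E => (extChartAt 𝓘(ℝ, E) (1 : G)).symm p.1 *
        (extChartAt 𝓘(ℝ, E) (1 : G)).symm p.2) (origin E G, origin E G) := by
    refine ContMDiffAt.mul ?_ ?_
    · exact ContMDiffAt.comp (x := (origin E G, origin E G)) (g := (extChartAt 𝓘(ℝ, E) (1 : G)).symm)
        contMDiffAt_symm_origin contDiffAt_fst.contMDiffAt
    · exact ContMDiffAt.comp (x := (origin E G, origin E G)) (g := (extChartAt 𝓘(ℝ, E) (1 : G)).symm)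
        contMDiffAt_symm_origin contDiffAt_snd.contMDiffAt
  exact ContMDiffAt.comp (x := (origin E G, origin E G)) (g := extChartAt 𝓘(ℝ, E) (1 : G))
    h0 h1

/-- Products near the identity are computed by `chartMul`. -/
theorem symm_chartMul : ∀ᶠ p in 𝓝 (origin E G, origin E G),
    (extChartAt 𝓘(ℝ, E) (1 : G)).symm (chartMul G p) =
      (extChartAt 𝓘(ℝ, E) (1 : G)).symm p.1 * (extChartAt 𝓘(ℝ, E) (1 : G)).symm p.2 := by
  have hc : ContinuousAt (fun p : E × E => (extChartAt 𝓘(ℝ, E) (1 : G)).symm p.1 *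
        (extChartAt 𝓘(ℝ, E) (1 : G)).symm p.2) (origin E G, origin E G) := by
    have h1 : ContinuousAt (fun p : E × E => (extChartAt 𝓘(ℝ, E) (1 : G)).symm p.1)
        (origin E G, origin E G) :=
      ContinuousAt.comp (x := (origin E G, origin E G)) (g := (extChartAt 𝓘(ℝ, E) (1 : G)).symm)
        contMDiffAt_symm_origin.continuousAt continuousAt_fst
    have h2 : ContinuousAt (fun p : E × E => (extChartAt 𝓘(ℝ, E) (1 : G)).symm p.2)
        (origin E G, origin E G) :=
      ContinuousAt.comp (x := (origin E G, origin E G)) (g := (extChartAt 𝓘(ℝ, E) (1 : G)).symm)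
        contMDiffAt_symm_origin.continuousAt continuousAt_snd
    have : ContinuousMul G := continuousMul_of_contMDiffMul 𝓘(ℝ, E) ∞
    exact h1.mul h2
  have hs : (extChartAt 𝓘(ℝ, E) (1 : G)).source ∈ 𝓝
      ((extChartAt 𝓘(ℝ, E) (1 : G)).symm (origin E G) *
        (extChartAt 𝓘(ℝ, E) (1 : G)).symm (origin E G)) := by
    rw [symm_origin, one_mul]; exact extChartAt_source_mem_nhds (I := 𝓘(ℝ, E)) (1 : G)
  filter_upwards [hc.tendsto.eventually hs] with p hp
  exact (extChartAt 𝓘(ℝ, E) (1 : G)).left_inv hp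

end Chart

/-! ### Left and right translations in the chart, and the Lie bracket as a second derivative of the
multiplication. -/

section Derivative

variable {E : Type*} [NormedAddCommGroup E] [NormedSpace ℝ E]
  {G : Type*} [TopologicalSpace G] [ChartedSpace E G] [Group G] [LieGroup 𝓘(ℝ, E) ∞ G]
  {V : Type*} [NormedAddCommGroup V] [NormedSpace ℝ V]

theorem mdifferentiableAt_one_iff (f : G → V) :
    MDifferentiableAt 𝓘(ℝ, E) 𝓘(ℝ, V) f 1 ↔
      DifferentiableAt ℝ (fun x : E => f ((extChartAt 𝓘(ℝ, E) (1 : G)).symm x)) (origin E G) := by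
  constructor
  · intro h
    rw [← mdifferentiableAt_iff_differentiableAt]
    have h1 : MDifferentiableAt 𝓘(ℝ, E) 𝓘(ℝ, V) f
      ((extChartAt 𝓘(ℝ, E) (1 : G)).symm (origin E G)) := by rwa [symm_origin]
    exact h1.comp (origin E G) (contMDiffAt_symm_origin.mdifferentiableAt (by simp))
  · intro h
    rw [← mdifferentiableAt_iff_differentiableAt] at h
    have h1 : MDifferentiableAt 𝓘(ℝ, E) 𝓘(ℝ, V)
        ((fun x : E => f ((extChartAt 𝓘(ℝ, E) (1 : G)).symm x)) ∘ extChartAt 𝓘(ℝ, E) (1 : G)) 1 :=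
      MDifferentiableAt.comp (1 : G) h (contMDiffAt_extChartAt.mdifferentiableAt one_ne_zero)
    refine h1.congr_of_eventuallyEq ?_
    filter_upwards [extChartAt_source_mem_nhds (I := 𝓘(ℝ, E)) (1 : G)] with h hh
    simp only [Function.comp]
    rw [(extChartAt 𝓘(ℝ, E) (1 : G)).left_inv hh]

/-- The differential at the identity, computed in the preferred chart. -/
theorem mfderiv_one (f : G → V) :
    (mfderiv 𝓘(ℝ, E) 𝓘(ℝ, V) f 1 : E →L[ℝ] V) =
      fderiv ℝ (fun x : E => f ((extChartAt 𝓘(ℝ, E) (1 : G)).symm x)) (origin E G) := by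
  by_cases h : MDifferentiableAt 𝓘(ℝ, E) 𝓘(ℝ, V) f 1
  · refine (MDifferentiableAt.mfderiv h).trans ?_
    change fderivWithin ℝ (fun x : E => f ((extChartAt 𝓘(ℝ, E) (1 : G)).symm x))
      (Set.range (id : E → E)) (origin E G) = _
    rw [Set.range_id, fderivWithin_univ]
  · rw [mfderiv_zero_of_not_mdifferentiableAt h, fderiv_zero_of_not_differentiableAt]
    · rfl
    · rwa [← mdifferentiableAt_one_iff]

theorem lieDeriv_eq_fderiv (f : G → ℝ) (g : G) :
    (lieDeriv f g : E →L[ℝ] ℝ) = fderiv ℝ (fun x : E => f (rightParam g x)) (origin E G) :=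
  mfderiv_one (fun h : G => f (h * g))

variable (G) in
/-- The differential at the identity of right multiplication, in the preferred chart. -/
def rightDiff (x : E) : E →L[ℝ] E :=
  (fderiv ℝ (chartMul G) (origin E G, x)).comp (ContinuousLinearMap.inl ℝ E E)

variable (G) in
/-- The differential at the identity of left multiplication, in the preferred chart. -/
def leftDiff (x : E) : E →L[ℝ] E :=
  (fderiv ℝ (chartMul G) (x, origin E G)).comp (ContinuousLinearMap.inr ℝ E E)

theorem contDiffAt_fderiv_chartMul :
    ContDiffAt ℝ ∞ (fderiv ℝ (chartMul G : E × E → E)) (origin E G, origin E G) :=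
  contDiffAt_chartMul.fderiv_right (by simp)

theorem contDiffAt_rightDiff : ContDiffAt ℝ ∞ (rightDiff G : E → E →L[ℝ] E) (origin E G) := by
  have h : ContDiffAt ℝ ∞ (fun x : E => fderiv ℝ (chartMul G) (origin E G, x)) (origin E G) :=
    ContDiffAt.comp (origin E G) (f := fun x : E => (origin E G, x))
      contDiffAt_fderiv_chartMul (contDiffAt_const.prodMk contDiffAt_id)
  exact h.clm_comp contDiffAt_const

theorem contDiffAt_leftDiff : ContDiffAt ℝ ∞ (leftDiff G : E → E →L[ℝ] E) (origin E G) := by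
  have h : ContDiffAt ℝ ∞ (fun x : E => fderiv ℝ (chartMul G) (x, origin E G)) (origin E G) :=
    ContDiffAt.comp (origin E G) (f := fun x : E => (x, origin E G))
      contDiffAt_fderiv_chartMul (contDiffAt_id.prodMk contDiffAt_const)
  exact h.clm_comp contDiffAt_const

theorem eventually_differentiableAt_chartMul : ∀ᶠ p in 𝓝 (origin E G, origin E G),
    DifferentiableAt ℝ (chartMul G) p := by
  have h : ContDiffAt ℝ 1 (chartMul G : E × E → E) (origin E G, origin E G) :=
    contDiffAt_chartMul.of_le (by exact_mod_cast le_top)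
  filter_upwards [h.eventually (by simp)] with p hp
  exact hp.differentiableAt one_ne_zero

theorem hasFDerivAt_chartMul_left : ∀ᶠ x in 𝓝 (origin E G),
    HasFDerivAt (fun z : E => chartMul G (z, x)) (rightDiff G x) (origin E G) := by
  have h : Tendsto (fun x : E => (origin E G, x)) (𝓝 (origin E G)) (𝓝 (origin E G, origin E G)) :=
    (continuous_const.prodMk continuous_id).tendsto _
  filter_upwards [h.eventually eventually_differentiableAt_chartMul] with x hx
  exact HasFDerivAt.comp (origin E G) (g := chartMul G) (f := fun z : E => (z, x)) hx.hasFDerivAt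
    (hasFDerivAt_prodMk_left (origin E G) x)

theorem hasFDerivAt_chartMul_right : ∀ᶠ x in 𝓝 (origin E G),
    HasFDerivAt (fun z : E => chartMul G (x, z)) (leftDiff G x) (origin E G) := by
  have h : Tendsto (fun x : E => (x, origin E G)) (𝓝 (origin E G)) (𝓝 (origin E G, origin E G)) :=
    (continuous_id.prodMk continuous_const).tendsto _
  filter_upwards [h.eventually eventually_differentiableAt_chartMul] with x hx
  exact HasFDerivAt.comp (origin E G) (g := chartMul G) (f := fun z : E => (x, z)) hx.hasFDerivAt
    (hasFDerivAt_prodMk_right x (origin E G))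

theorem rightDiff_origin : rightDiff G (origin E G) = ContinuousLinearMap.id ℝ E := by
  have h := (hasFDerivAt_chartMul_left (E := E) (G := G)).self_of_nhds
  exact h.unique ((hasFDerivAt_id _).congr_of_eventuallyEq chartMul_origin_right)

theorem leftDiff_origin : leftDiff G (origin E G) = ContinuousLinearMap.id ℝ E := by
  have h := (hasFDerivAt_chartMul_right (E := E) (G := G)).self_of_nhds
  exact h.unique ((hasFDerivAt_id _).congr_of_eventuallyEq chartMul_origin_left)

theorem fderiv_rightDiff (u v : E) : fderiv ℝ (rightDiff G) (origin E G) u v =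
    fderiv ℝ (fderiv ℝ (chartMul G)) (origin E G, origin E G) (0, u) (v, 0) := by
  have h := HasFDerivAt.comp (origin E G) (g := fderiv ℝ (chartMul G))
      (f := fun x : E => (origin E G, x))
      ((contDiffAt_fderiv_chartMul (E := E) (G := G)).differentiableAt (by simp)).hasFDerivAt
      (hasFDerivAt_prodMk_right (origin E G) (origin E G))
  have h2 := h.clm_comp (hasFDerivAt_const (ContinuousLinearMap.inl ℝ E E) (origin E G))
  have h3 : fderiv ℝ (rightDiff G) (origin E G) = _ := h2.fderiv
  rw [h3]
  simp

theorem fderiv_leftDiff (u v : E) : fderiv ℝ (leftDiff G) (origin E G) u v =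
    fderiv ℝ (fderiv ℝ (chartMul G)) (origin E G, origin E G) (u, 0) (0, v) := by
  have h := HasFDerivAt.comp (origin E G) (g := fderiv ℝ (chartMul G))
      (f := fun x : E => (x, origin E G))
      ((contDiffAt_fderiv_chartMul (E := E) (G := G)).differentiableAt (by simp)).hasFDerivAt
      (hasFDerivAt_prodMk_left (origin E G) (origin E G))
  have h2 := h.clm_comp (hasFDerivAt_const (ContinuousLinearMap.inr ℝ E E) (origin E G))
  have h3 : fderiv ℝ (leftDiff G) (origin E G) = _ := h2.fderiv
  rw [h3]
  simp

/-- Both sides are the mixed second derivative of the multiplication at the identity, in the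
directions `(u, 0)` and `(0, v)`. -/
theorem fderiv_leftDiff_eq (u v : E) : fderiv ℝ (leftDiff G) (origin E G) u v =
    fderiv ℝ (rightDiff G) (origin E G) v u := by
  rw [fderiv_leftDiff, fderiv_rightDiff]
  have h : ContDiffAt ℝ 2 (chartMul G : E × E → E) (origin E G, origin E G) :=
    contDiffAt_chartMul.of_le (WithTop.coe_le_coe.2 le_top)
  exact (h.isSymmSndFDerivAt (by simp)).eq _ _

theorem eventually_eventually_symm_chartMul_right : ∀ᶠ x in 𝓝 (origin E G),
    ∀ᶠ z in 𝓝 (origin E G), (extChartAt 𝓘(ℝ, E) (1 : G)).symm (chartMul G (x, z)) =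
      (extChartAt 𝓘(ℝ, E) (1 : G)).symm x * (extChartAt 𝓘(ℝ, E) (1 : G)).symm z :=
  (symm_chartMul (E := E) (G := G)).curry_nhds

theorem eventually_eventually_symm_chartMul_left : ∀ᶠ x in 𝓝 (origin E G),
    ∀ᶠ z in 𝓝 (origin E G), (extChartAt 𝓘(ℝ, E) (1 : G)).symm (chartMul G (z, x)) =
      (extChartAt 𝓘(ℝ, E) (1 : G)).symm z * (extChartAt 𝓘(ℝ, E) (1 : G)).symm x := by
  have h : Tendsto (Prod.swap : E × E → E × E) (𝓝 (origin E G, origin E G))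
      (𝓝 (origin E G, origin E G)) := continuous_swap.tendsto _
  exact (h.eventually (symm_chartMul (E := E) (G := G))).curry_nhds

/-- The point `y` is kept separate from `f x` so that base points that agree only propositionally
can be matched without rewriting inside tangent spaces. -/
theorem hasMFDerivAt_comp_of_eq {E₁ E₂ E₃ M₁ M₂ M₃ : Type*}
    [NormedAddCommGroup E₁] [NormedSpace ℝ E₁] [TopologicalSpace M₁] [ChartedSpace E₁ M₁]
    [NormedAddCommGroup E₂] [NormedSpace ℝ E₂] [TopologicalSpace M₂] [ChartedSpace E₂ M₂]
    [NormedAddCommGroup E₃] [NormedSpace ℝ E₃] [TopologicalSpace M₃] [ChartedSpace E₃ M₃]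
    {f : M₁ → M₂} {g : M₂ → M₃} {x : M₁} {y : M₂} {f' : E₁ →L[ℝ] E₂} {g' : E₂ →L[ℝ] E₃}
    (hg : HasMFDerivAt 𝓘(ℝ, E₂) 𝓘(ℝ, E₃) g y g') (hf : HasMFDerivAt 𝓘(ℝ, E₁) 𝓘(ℝ, E₂) f x f')
    (hy : f x = y) : HasMFDerivAt 𝓘(ℝ, E₁) 𝓘(ℝ, E₃) (g ∘ f) x (g'.comp f' : E₁ →L[ℝ] E₃) := by
  subst hy; exact HasMFDerivAt.comp x hg hf

/-- Differentiating `symm (chartMul (x, z)) = symm x * symm z` in `z` at the origin: `x ↦ leftDiff G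
x v` is the left-invariant field of `v` read in the chart. -/
theorem mfderiv_symm_leftDiff : ∀ᶠ x in 𝓝 (origin E G), ∀ v : E,
    (mfderivWithin 𝓘(ℝ, E) 𝓘(ℝ, E) (extChartAt 𝓘(ℝ, E) (1 : G)).symm
      (Set.range 𝓘(ℝ, E)) x : E →L[ℝ] E) (leftDiff G x v) =
    (mulInvariantVectorField (I := 𝓘(ℝ, E)) (G := G) v
      ((extChartAt 𝓘(ℝ, E) (1 : G)).symm x) : E) := by
  filter_upwards [target_mem_nhds_origin (E := E) (G := G), chartMul_origin_right (E := E) (G := G),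
    hasFDerivAt_chartMul_right (E := E) (G := G),
    eventually_eventually_symm_chartMul_right (E := E) (G := G)] with x hx hx1 hx2 hx3 v
  have hr : Set.range 𝓘(ℝ, E) = Set.univ := Set.range_id
  have hs : HasMFDerivAt 𝓘(ℝ, E) 𝓘(ℝ, E) (extChartAt 𝓘(ℝ, E) (1 : G)).symm x
      (mfderivWithin 𝓘(ℝ, E) 𝓘(ℝ, E) (extChartAt 𝓘(ℝ, E) (1 : G)).symm (Set.range 𝓘(ℝ, E)) x) := by
    rw [hr, mfderivWithin_univ]
    exact ((contMDiffAt_symm_of_mem hx).mdifferentiableAt (by simp)).hasMFDerivAt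
  have h1 := hasMFDerivAt_comp_of_eq hs hx2.hasMFDerivAt hx1
  have ho : HasMFDerivAt 𝓘(ℝ, E) 𝓘(ℝ, E) (extChartAt 𝓘(ℝ, E) (1 : G)).symm (origin E G)
      (ContinuousLinearMap.id ℝ E) := by
    have h := (contMDiffAt_symm_origin (E := E) (G := G)).mdifferentiableAt (by simp)
    have h2 : HasMFDerivAt _ _ _ _ _ := h.hasMFDerivAt
    have h3 := mfderivWithin_range_extChartAt_symm (I := 𝓘(ℝ, E)) (x := (1 : G))
    rw [hr, mfderivWithin_univ] at h3
    exact h2.congr_mfderiv h3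
  have hm : HasMFDerivAt 𝓘(ℝ, E) 𝓘(ℝ, E)
      (fun h : G => (extChartAt 𝓘(ℝ, E) (1 : G)).symm x * h) 1
      (mfderiv 𝓘(ℝ, E) 𝓘(ℝ, E) (fun h : G => (extChartAt 𝓘(ℝ, E) (1 : G)).symm x * h) 1) :=
    ((contMDiff_mul_left (I := 𝓘(ℝ, E)) (n := ∞)).contMDiffAt.mdifferentiableAt
      (by simp)).hasMFDerivAt
  have h2 := hasMFDerivAt_comp_of_eq hm ho symm_origin
  have h4 := hasMFDerivAt_unique h1 (h2.congr_of_eventuallyEq hx3)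
  exact congrArg (fun A : E →L[ℝ] E => A v) h4

variable (G) in
/-- The Lie bracket of `𝔤`, on the underlying space `E`. -/
def lieBr (v w : E) : E := Bracket.bracket (L := Lie E G) (M := Lie E G) v w

/-- The bracket of `𝔤` is that of left-invariant fields, whose chart expressions are `leftDiff G ·
v` and `leftDiff G · w`; at the origin these take the values `v` and `w`. -/
theorem lieBr_eq_leftDiff (v w : E) : lieBr G v w =
    fderiv ℝ (leftDiff G) (origin E G) v w - fderiv ℝ (leftDiff G) (origin E G) w v := by
  have h0 : (mfderiv 𝓘(ℝ, E) 𝓘(ℝ, E) (extChartAt 𝓘(ℝ, E) (1 : G)) 1 : E →L[ℝ] E) =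
    ContinuousLinearMap.id ℝ E := mfderiv_extChartAt_self
  have hr : Set.range 𝓘(ℝ, E) = Set.univ := Set.range_id
  have key : ∀ u : E, VectorField.mpullbackWithin 𝓘(ℝ, E) 𝓘(ℝ, E)
      (extChartAt 𝓘(ℝ, E) (1 : G)).symm (mulInvariantVectorField (I := 𝓘(ℝ, E)) (G := G) u)
      (Set.range 𝓘(ℝ, E)) =ᶠ[𝓝 (origin E G)] fun x => leftDiff G x u := by
    intro u
    filter_upwards [mfderiv_symm_leftDiff (E := E) (G := G),
      target_mem_nhds_origin (E := E) (G := G)] with x hx hx2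
    rw [VectorField.mpullbackWithin_apply, ← hx u]
    exact (isInvertible_mfderivWithin_extChartAt_symm hx2).inverse_apply_eq.2 rfl
  -- The bracket unfolds to the inverse of the chart differential at `1`, here the identity, applied
  -- to the bracket of the fields in the chart.
  have hi : ∀ (A : E →L[ℝ] E) (x y : E), A = ContinuousLinearMap.id ℝ E → x = y →
      A.inverse x = y := by
    rintro A x y rfl rfl
    rw [ContinuousLinearMap.inverse_id, ContinuousLinearMap.id_apply]
  refine hi _ _ _ h0 ?_
  change VectorField.lieBracketWithin ℝ
      (VectorField.mpullbackWithin 𝓘(ℝ, E) 𝓘(ℝ, E) (extChartAt 𝓘(ℝ, E) (1 : G)).symm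
        (mulInvariantVectorField (I := 𝓘(ℝ, E)) (G := G) v) (Set.range 𝓘(ℝ, E)))
      (VectorField.mpullbackWithin 𝓘(ℝ, E) 𝓘(ℝ, E) (extChartAt 𝓘(ℝ, E) (1 : G)).symm
        (mulInvariantVectorField (I := 𝓘(ℝ, E)) (G := G) w) (Set.range 𝓘(ℝ, E)))
      ((extChartAt 𝓘(ℝ, E) (1 : G)).symm ⁻¹' Set.univ ∩ Set.range 𝓘(ℝ, E)) (origin E G) = _
  rw [(key v).lieBracketWithin_vectorField_eq_nhds (key w)]
  have hd : ∀ u : E, fderiv ℝ (fun x => leftDiff G x u) (origin E G) =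
      (fderiv ℝ (leftDiff G) (origin E G)).flip u := by
    intro u
    have h := ((contDiffAt_leftDiff (E := E) (G := G)).differentiableAt (by simp)).hasFDerivAt
    exact (h.clm_apply (hasFDerivAt_const u (origin E G))).fderiv.trans (by ext; simp)
  rw [hr, Set.preimage_univ, Set.univ_inter, VectorField.lieBracketWithin_univ,
    VectorField.lieBracket, hd, hd, leftDiff_origin]
  rfl

theorem lieBr_eq_rightDiff (v w : E) : lieBr G v w =
    fderiv ℝ (rightDiff G) (origin E G) w v - fderiv ℝ (rightDiff G) (origin E G) v w := by
  rw [lieBr_eq_leftDiff, fderiv_leftDiff_eq, fderiv_leftDiff_eq]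

end Derivative

/-! ### Smoothness of the adjoint action and its differential. -/

section AdjointDerivative

variable {E : Type*} [NormedAddCommGroup E] [NormedSpace ℝ E]
  {G : Type*} [TopologicalSpace G] [ChartedSpace E G] [Group G] [LieGroup 𝓘(ℝ, E) ∞ G]

/-- The Lie derivatives of `f` near `g` are computed in the right translated chart. -/
theorem lieDeriv_rightParam : ∀ᶠ x in 𝓝 (origin E G), ∀ (f : G → ℝ) (g : G),
    DifferentiableAt ℝ (fun y : E => f (rightParam g y)) x →
      (lieDeriv f (rightParam g x) : E →L[ℝ] ℝ) =
        (fderiv ℝ (fun y : E => f (rightParam g y)) x).comp (rightDiff G x) := by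
  -- This neighbourhood depends on the chart alone, so that later `f` may itself vary with the
  -- point.
  filter_upwards [chartMul_origin_left (E := E) (G := G),
    hasFDerivAt_chartMul_left (E := E) (G := G),
    eventually_eventually_symm_chartMul_left (E := E) (G := G)] with x hx1 hx2 hx3 f g hf
  rw [lieDeriv_eq_fderiv]
  have h1 : HasFDerivAt ((fun y : E => f (rightParam g y)) ∘ fun z : E => chartMul G (z, x))
      ((fderiv ℝ (fun y : E => f (rightParam g y)) x).comp (rightDiff G x)) (origin E G) := by
    refine HasFDerivAt.comp (origin E G) ?_ hx2
    rw [hx1]; exact hf.hasFDerivAt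
  refine (h1.congr_of_eventuallyEq ?_).fderiv
  filter_upwards [hx3] with z hz
  simp only [Function.comp, rightParam, hz, mul_assoc]

variable (E) in
/-- The adjoint action as an operator on the space underlying `𝔤`. -/
def adOp (g : G) : E →L[ℝ] E := Ad (E := E) g

theorem adOp_mul (g h : G) : adOp E (g * h) = (adOp E g).comp (adOp E h) := by
  ext v; exact Ad_mul g h v

theorem contMDiff_conj (g : G) :
    ContMDiff 𝓘(ℝ, E) 𝓘(ℝ, E) ∞ (fun h : G => g * h * g⁻¹) :=
  (contMDiff_const.mul contMDiff_id).mul contMDiff_const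

theorem hasMFDerivAt_conj (g : G) :
    HasMFDerivAt 𝓘(ℝ, E) 𝓘(ℝ, E) (fun h : G => g * h * g⁻¹) 1 (adOp E g) :=
  ((contMDiff_conj g).mdifferentiableAt (by simp)).hasMFDerivAt

theorem adOp_one : adOp E (1 : G) = ContinuousLinearMap.id ℝ E := by
  have h := hasMFDerivAt_conj (E := E) (1 : G)
  have h2 : HasMFDerivAt 𝓘(ℝ, E) 𝓘(ℝ, E) (fun h : G => 1 * h * 1⁻¹) 1
      (ContinuousLinearMap.id ℝ E) :=
    (hasMFDerivAt_id (I := 𝓘(ℝ, E)) (1 : G)).congr_of_eventuallyEq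
      (Eventually.of_forall fun x => by simp)
  exact hasMFDerivAt_unique h h2

theorem adOp_inv_apply (g : G) (v : E) : adOp E g⁻¹ (adOp E g v) = v := by
  rw [← ContinuousLinearMap.comp_apply, ← adOp_mul, inv_mul_cancel, adOp_one]; rfl

/-- This is `k h = (k h k⁻¹) k` differentiated in `h` at the identity. -/
theorem leftDiff_eq_comp_adOp : ∀ᶠ x in 𝓝 (origin E G),
    leftDiff G x =
      (rightDiff G x).comp (adOp E ((extChartAt 𝓘(ℝ, E) (1 : G)).symm x)) := by
  filter_upwards [hasFDerivAt_chartMul_left (E := E) (G := G),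
    hasFDerivAt_chartMul_right (E := E) (G := G)] with x hx1 hx2
  set k : G := (extChartAt 𝓘(ℝ, E) (1 : G)).symm x with hk
  have hd1 := hx1.differentiableAt
  have hd2 := hx2.differentiableAt
  have hr : HasMFDerivAt 𝓘(ℝ, E) 𝓘(ℝ, E)
      (fun h : G => extChartAt 𝓘(ℝ, E) (1 : G) (h * k)) 1 (rightDiff G x : E →L[ℝ] E) := by
    have hd : MDifferentiableAt 𝓘(ℝ, E) 𝓘(ℝ, E)
      (fun h : G => extChartAt 𝓘(ℝ, E) (1 : G) (h * k)) 1 :=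
      (mdifferentiableAt_one_iff (V := E) _).2 hd1
    have h := hd.hasMFDerivAt
    have h2 := mfderiv_one (E := E) (V := E) (fun h : G => extChartAt 𝓘(ℝ, E) (1 : G) (h * k))
    have h3 := hx1.fderiv
    exact h.congr_mfderiv (h2.trans h3)
  have hl : HasMFDerivAt 𝓘(ℝ, E) 𝓘(ℝ, E)
      (fun h : G => extChartAt 𝓘(ℝ, E) (1 : G) (k * h)) 1 (leftDiff G x : E →L[ℝ] E) := by
    have hd : MDifferentiableAt 𝓘(ℝ, E) 𝓘(ℝ, E)
      (fun h : G => extChartAt 𝓘(ℝ, E) (1 : G) (k * h)) 1 :=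
      (mdifferentiableAt_one_iff (V := E) _).2 hd2
    have h := hd.hasMFDerivAt
    have h2 := mfderiv_one (E := E) (V := E) (fun h : G => extChartAt 𝓘(ℝ, E) (1 : G) (k * h))
    have h3 := hx2.fderiv
    exact h.congr_mfderiv (h2.trans h3)
  have hc := hasMFDerivAt_comp_of_eq hr (hasMFDerivAt_conj k) (by simp)
  have he : ((fun h : G => extChartAt 𝓘(ℝ, E) (1 : G) (h * k)) ∘ fun h : G => k * h * k⁻¹) =
      fun h : G => extChartAt 𝓘(ℝ, E) (1 : G) (k * h) := by
    funext h; simp [mul_assoc]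
  rw [he] at hc
  exact hasMFDerivAt_unique hl hc

theorem adOp_rightParam (g : G) (x v : E) : adOp E (rightParam g x) v =
    adOp E ((extChartAt 𝓘(ℝ, E) (1 : G)).symm x) (adOp E g v) := by
  rw [rightParam, adOp_mul]; rfl

variable [FiniteDimensional ℝ E]

/-- Near the origin `Ad` is `(rightDiff)⁻¹ ∘ leftDiff`, and inversion of operators is smooth at the
identity. -/
theorem contDiffAt_adOp_symm : ContDiffAt ℝ ∞
    (fun x : E => adOp E ((extChartAt 𝓘(ℝ, E) (1 : G)).symm x)) (origin E G) := by
  have hinv : ContDiffAt ℝ ∞ (fun x : E => (rightDiff G x).inverse) (origin E G) := by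
    refine ContDiffAt.comp (origin E G) (g := ContinuousLinearMap.inverse) ?_ contDiffAt_rightDiff
    rw [rightDiff_origin]
    exact contDiffAt_map_inverse (ContinuousLinearEquiv.refl ℝ E)
  have hu : ∀ᶠ x in 𝓝 (origin E G), (rightDiff G x).IsInvertible := by
    have h := (contDiffAt_rightDiff (E := E) (G := G)).continuousAt.tendsto
    rw [rightDiff_origin] at h
    exact h.eventually (ContinuousLinearEquiv.nhds (ContinuousLinearEquiv.refl ℝ E))
  refine (hinv.clm_comp contDiffAt_leftDiff).congr_of_eventuallyEq ?_
  filter_upwards [hu, leftDiff_eq_comp_adOp (E := E) (G := G)] with x hx1 hx2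
  rw [hx2]
  ext v
  exact ((hx1.inverse_apply_eq).2 rfl).symm

/-- The differential of the adjoint action at the identity is the Lie bracket. -/
theorem hasFDerivAt_adOp_symm_apply (u v : E) :
    fderiv ℝ (fun x : E => adOp E ((extChartAt 𝓘(ℝ, E) (1 : G)).symm x) v) (origin E G) u =
      lieBr G u v := by
  have hA := ((contDiffAt_adOp_symm (E := E) (G := G)).differentiableAt (by simp)).hasFDerivAt
  have hAv := hA.clm_apply (hasFDerivAt_const v (origin E G))
  have hR := ((contDiffAt_rightDiff (E := E) (G := G)).differentiableAt (by simp)).hasFDerivAt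
  have hL := ((contDiffAt_leftDiff (E := E) (G := G)).differentiableAt (by simp)).hasFDerivAt
  have h1 := hR.clm_apply hAv
  have h2 := hL.clm_apply (hasFDerivAt_const v (origin E G))
  -- The product rule applied to this identity gives `D leftDiff(u) v = D rightDiff(u) v + D Ad(u)
  -- v`, and the difference of the first two terms is the bracket.
  have he : (fun x : E => leftDiff G x v) =ᶠ[𝓝 (origin E G)] fun x =>
      rightDiff G x (adOp E ((extChartAt 𝓘(ℝ, E) (1 : G)).symm x) v) := by
    filter_upwards [leftDiff_eq_comp_adOp (E := E) (G := G)] with x hx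
    rw [hx]; rfl
  have h3 := congrArg (fun A : E →L[ℝ] E => A u) (h2.unique (h1.congr_of_eventuallyEq he))
  rw [hAv.fderiv, lieBr_eq_leftDiff, fderiv_leftDiff_eq v u]
  rw [symm_origin, adOp_one, rightDiff_origin] at h3
  simp at h3 ⊢
  rw [h3]; abel

end AdjointDerivative

/-! ### Smoothness tested in right translated charts. -/

section Regularity

variable {E : Type*} [NormedAddCommGroup E] [NormedSpace ℝ E]
  {G : Type*} [TopologicalSpace G] [ChartedSpace E G] [Group G] [LieGroup 𝓘(ℝ, E) ∞ G]
  {F V : Type*} [NormedAddCommGroup F] [NormedSpace ℝ F] [NormedAddCommGroup V] [NormedSpace ℝ V]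

theorem contMDiffAt_rightParam_comp {f : G → V} {g : G} :
    ContMDiffAt 𝓘(ℝ, E) 𝓘(ℝ, V) ∞ f g ↔
      ContDiffAt ℝ ∞ (fun x : E => f (rightParam g x)) (origin E G) := by
  rw [← contMDiffAt_iff_contDiffAt]
  constructor
  · intro h
    rw [← rightParam_origin (E := E) g] at h
    refine ContMDiffAt.comp (origin E G) (g := f) h ?_
    exact contMDiffAt_rightParam g
  · intro h
    rw [← rightChart_self g] at h
    refine (ContMDiffAt.comp g h (contMDiffAt_rightChart g)).congr_of_eventuallyEq ?_
    filter_upwards [rightParam_rightChart (E := E) g] with k hk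
    simp only [Function.comp, hk]

theorem contMDiffAt_prod_rightParam_comp {f : G × F → V} {g : G} {m : F} :
    ContMDiffAt (𝓘(ℝ, E).prod 𝓘(ℝ, F)) 𝓘(ℝ, V) ∞ f (g, m) ↔
      ContDiffAt ℝ ∞ (fun p : E × F => f (rightParam g p.1, p.2)) (origin E G, m) := by
  rw [← contMDiffAt_iff_contDiffAt]
  constructor
  · intro h
    rw [← rightParam_origin (E := E) g] at h
    refine ContMDiffAt.comp (origin E G, m) (g := f) h ?_
    refine ContMDiffAt.prodMk ?_ contDiffAt_snd.contMDiffAt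
    exact ContMDiffAt.comp (x := (origin E G, m)) (g := rightParam g)
      (contMDiffAt_rightParam g) contDiffAt_fst.contMDiffAt
  · intro h
    rw [← rightChart_self g] at h
    have h2 : ContMDiffAt (𝓘(ℝ, E).prod 𝓘(ℝ, F)) 𝓘(ℝ, E × F) ∞
        (fun q : G × F => ((rightChart g q.1 : E), q.2)) (g, m) := by
      refine ContMDiffAt.prodMk_space ?_ contMDiffAt_snd
      exact ContMDiffAt.comp (x := (g, m)) (g := rightChart g)
        (contMDiffAt_rightChart g) contMDiffAt_fst
    refine (ContMDiffAt.comp (g, m) h h2).congr_of_eventuallyEq ?_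
    have h3 := continuousAt_fst.tendsto (x := (g, m)) |>.eventually
      (rightParam_rightChart (E := E) g)
    filter_upwards [h3] with k hk
    simp only [Function.comp, hk]

theorem contMDiffAt_prod_rightParam_comp₂ {f : G × G → V} {g g' : G} :
    ContMDiffAt (𝓘(ℝ, E).prod 𝓘(ℝ, E)) 𝓘(ℝ, V) ∞ f (g, g') ↔
      ContDiffAt ℝ ∞ (fun p : E × E => f (rightParam g p.1, rightParam g' p.2))
        (origin E G, origin E G) := by
  rw [← contMDiffAt_iff_contDiffAt]
  constructor
  · intro h
    rw [← rightParam_origin (E := E) g, ← rightParam_origin (E := E) g'] at h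
    refine ContMDiffAt.comp (origin E G, origin E G) (g := f) h ?_
    refine ContMDiffAt.prodMk ?_ ?_
    · exact ContMDiffAt.comp (x := (origin E G, origin E G)) (g := rightParam g)
        (contMDiffAt_rightParam g) contDiffAt_fst.contMDiffAt
    · exact ContMDiffAt.comp (x := (origin E G, origin E G)) (g := rightParam g')
        (contMDiffAt_rightParam g') contDiffAt_snd.contMDiffAt
  · intro h
    rw [show ((origin E G, origin E G) : E × E) = (rightChart g g, rightChart g' g') by
      rw [rightChart_self, rightChart_self]] at h
    have h2 : ContMDiffAt (𝓘(ℝ, E).prod 𝓘(ℝ, E)) 𝓘(ℝ, E × E) ∞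
        (fun q : G × G => ((rightChart g q.1 : E), (rightChart g' q.2 : E))) (g, g') := by
      refine ContMDiffAt.prodMk_space ?_ ?_
      · exact ContMDiffAt.comp (x := (g, g')) (g := rightChart g)
          (contMDiffAt_rightChart g) contMDiffAt_fst
      · exact ContMDiffAt.comp (x := (g, g')) (g := rightChart g')
          (contMDiffAt_rightChart g') contMDiffAt_snd
    refine (ContMDiffAt.comp (g, g') h h2).congr_of_eventuallyEq ?_
    have h3 := continuousAt_fst.tendsto (x := (g, g')) |>.eventually
      (rightParam_rightChart (E := E) g)
    have h4 := continuousAt_snd.tendsto (x := (g, g')) |>.eventually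
      (rightParam_rightChart (E := E) g')
    filter_upwards [h3, h4] with k hk hk'
    simp only [Function.comp, hk, hk']

end Regularity

/-! ### Gradients on the adjoint orbit. -/

section Gradient

variable {E : Type*} [NormedAddCommGroup E] [NormedSpace ℝ E]
  {G : Type*} [TopologicalSpace G] [ChartedSpace E G] [Group G]
  {ζ : Lie E G}

theorem exists_toOrbit_eq (a : adOrbit ζ) : ∃ g : G, toOrbit ζ g = a := by
  obtain ⟨a, g, hg⟩ := a
  exact ⟨g, Subtype.ext hg⟩

theorem mulInvariantVectorField_one (v : E) :
    (mulInvariantVectorField (I := 𝓘(ℝ, E)) (G := G) v 1 : E) = v := by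
  have h : (mfderiv 𝓘(ℝ, E) 𝓘(ℝ, E) (fun h : G => 1 * h) 1 : E →L[ℝ] E) =
      ContinuousLinearMap.id ℝ E :=
    HasMFDerivAt.mfderiv ((hasMFDerivAt_id (I := 𝓘(ℝ, E)) (1 : G)).congr_of_eventuallyEq
      (Eventually.of_forall fun x => by simp))
  exact congrArg (fun A : E →L[ℝ] E => A v) h

variable [LieGroup 𝓘(ℝ, E) ∞ G]

theorem adAct_toOrbit (h g : G) : adAct h (toOrbit ζ g) = toOrbit ζ (h * g) :=
  Subtype.ext (Ad_mul h g ζ).symm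

variable [FiniteDimensional ℝ E]

theorem neg_lieBr (v w : E) : -lieBr G v w = lieBr G w v := lie_skew (L := Lie E G) w v

variable (G) in
/-- The operator `η ↦ [v, η]`, as a continuous linear map. -/
def adCLM (v : E) : E →L[ℝ] E :=
  LinearMap.toContinuousLinearMap (adMap (E := E) (G := G) v : E →ₗ[ℝ] E)

theorem adCLM_apply (v w : E) : adCLM G v w = lieBr G v w := rfl

theorem contMDiff_adOp_apply (v : E) : ContMDiff 𝓘(ℝ, E) 𝓘(ℝ, E) ∞ (fun g : G => adOp E g v) := by
  intro g
  rw [contMDiffAt_rightParam_comp]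
  simp only [adOp_rightParam]
  exact contDiffAt_adOp_symm.clm_apply contDiffAt_const

theorem hasMFDerivAt_adOp_apply_one (v : E) :
    HasMFDerivAt 𝓘(ℝ, E) 𝓘(ℝ, E) (fun g : G => adOp E g v) 1 (-adCLM G v) := by
  have h := ((contMDiff_adOp_apply (G := G) v 1).mdifferentiableAt (by simp)).hasMFDerivAt
  have h2 := mfderiv_one (E := E) (V := E) (fun g : G => adOp E g v)
  have h3 : fderiv ℝ (fun x : E => adOp E ((extChartAt 𝓘(ℝ, E) (1 : G)).symm x) v) (origin E G) =
      -adCLM G v := by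
    ext u
    rw [hasFDerivAt_adOp_symm_apply, neg_apply, adCLM_apply, neg_lieBr]
  exact h.congr_mfderiv (h2.trans h3)

/-- Differentiate `Ad (g h) v = Ad g (Ad h v)` in `h` at the identity. -/
theorem mfderiv_adOp_apply_mulInvariantVectorField (g : G) (v η : E) :
    (mfderiv 𝓘(ℝ, E) 𝓘(ℝ, E) (fun k : G => adOp E k v) g : E →L[ℝ] E)
      (mulInvariantVectorField (I := 𝓘(ℝ, E)) (G := G) η g) = -adOp E g (lieBr G v η) := by
  have h1 : HasMFDerivAt 𝓘(ℝ, E) 𝓘(ℝ, E) (fun k : G => adOp E k v) g _ :=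
    ((contMDiff_adOp_apply (G := G) v g).mdifferentiableAt (by simp)).hasMFDerivAt
  have hm : HasMFDerivAt 𝓘(ℝ, E) 𝓘(ℝ, E) (fun h : G => g * h) 1
      (mfderiv 𝓘(ℝ, E) 𝓘(ℝ, E) (fun h : G => g * h) 1) :=
    ((contMDiff_mul_left (I := 𝓘(ℝ, E)) (n := ∞)).contMDiffAt.mdifferentiableAt
      (by simp)).hasMFDerivAt
  have h2 := hasMFDerivAt_comp_of_eq h1 hm (mul_one g)
  have h3 := hasMFDerivAt_comp_of_eq (adOp E g).hasFDerivAt.hasMFDerivAt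
    (hasMFDerivAt_adOp_apply_one (G := G) v) rfl
  have he : (fun k : G => adOp E k v) ∘ (fun h : G => g * h) =
      (adOp E g) ∘ fun k : G => adOp E k v := by
    funext k; simp only [Function.comp, adOp_mul, ContinuousLinearMap.comp_apply]
  rw [he] at h2
  have h4 := congrArg (fun A : E →L[ℝ] E => A η) (hasMFDerivAt_unique h2 h3)
  refine h4.trans ?_
  change adOp E g (-lieBr G v η) = _
  rw [map_neg]

/-- If `η` commutes with `a`, it is tangent to a curve in the isotropy group of `a`. -/
theorem exists_curve_in_isotropy (a η : E) (h : lieBr G a η = 0) :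
    ∃ γ : ℝ → G, γ 0 = 1 ∧
      HasMFDerivAt 𝓘(ℝ, ℝ) 𝓘(ℝ, E) γ 0 ((1 : ℝ →L[ℝ] ℝ).smulRight η : ℝ →L[ℝ] E) ∧
      ∀ᶠ t in 𝓝 0, adOp E (γ t) a = a := by
  -- An integral curve of the left-invariant field of `η` plays the role of `e^{tη}`; it is needed
  -- for small `t` only. Along it the derivative of `Ad γ(t) a` is `-Ad γ(t) [a, η] = 0`.
  obtain ⟨γ, hγ0, hγ⟩ := exists_isMIntegralCurveAt_of_contMDiffAt_boundaryless
    (I := 𝓘(ℝ, E)) (M := G) (t₀ := 0) (x₀ := 1)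
    ((contMDiff_mulInvariantVectorField (I := 𝓘(ℝ, E)) (G := G) η 1).of_le (by simp))
  refine ⟨γ, hγ0, ?_, ?_⟩
  · have h1 := hγ.self_of_nhds
    have h2 : ∀ g : G, g = 1 → (mulInvariantVectorField (I := 𝓘(ℝ, E)) (G := G) η g : E) = η := by
      rintro g rfl; exact mulInvariantVectorField_one η
    refine h1.congr_mfderiv ?_
    exact congrArg (fun e : E => ((1 : ℝ →L[ℝ] ℝ).smulRight e : ℝ →L[ℝ] E)) (h2 _ hγ0)
  · have hd : ∀ᶠ t in 𝓝 0, HasFDerivAt (fun t => adOp E (γ t) a) (0 : ℝ →L[ℝ] E) t := by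
      filter_upwards [hγ] with t ht
      have h1 : HasMFDerivAt 𝓘(ℝ, E) 𝓘(ℝ, E) (fun k : G => adOp E k a) (γ t) _ :=
        ((contMDiff_adOp_apply (G := G) a (γ t)).mdifferentiableAt (by simp)).hasMFDerivAt
      refine ((hasMFDerivAt_comp_of_eq h1 ht rfl).congr_mfderiv ?_).hasFDerivAt
      refine ContinuousLinearMap.ext fun s => ?_
      have h2 := mfderiv_adOp_apply_mulInvariantVectorField (γ t) a η
      rw [h, map_zero, neg_zero] at h2
      change (mfderiv 𝓘(ℝ, E) 𝓘(ℝ, E) (fun k : G => adOp E k a) (γ t) : E →L[ℝ] E)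
        (s • (mulInvariantVectorField (I := 𝓘(ℝ, E)) (G := G) η (γ t) : E)) = 0
      rw [map_smul]
      exact (congrArg (fun e : E => s • e) h2).trans (smul_zero s)
    obtain ⟨r, hr, hball⟩ := Metric.eventually_nhds_iff_ball.1 hd
    filter_upwards [Metric.ball_mem_nhds (0 : ℝ) hr] with t ht
    have hc := Metric.isOpen_ball.is_const_of_fderiv_eq_zero (𝕜 := ℝ)
      (convex_ball (0 : ℝ) r).isPreconnected
      (fun s hs => (hball s hs).differentiableAt.differentiableWithinAt)
      (fun s hs => (hball s hs).fderiv) ht (Metric.mem_ball_self hr)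
    rw [hc, hγ0, adOp_one]; rfl

/-- The differential of `h ↦ f(Ad h · a)` kills every `η` with `[a, η] = 0`, since such an `η` is
tangent to a curve fixing `a`. It therefore factors through `ad a`. -/
theorem exists_hasOrbitGradient (f : adOrbit ζ → ℝ) (a : adOrbit ζ)
    (hf : MDifferentiableAt 𝓘(ℝ, E) 𝓘(ℝ, ℝ) (fun h : G => f (adAct h a)) 1) :
    ∃ ν, HasOrbitGradient f a ν := by
  set T : E →L[ℝ] ℝ := mfderiv 𝓘(ℝ, E) 𝓘(ℝ, ℝ) (fun h : G => f (adAct h a)) 1 with hT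
  have hd : HasMFDerivAt 𝓘(ℝ, E) 𝓘(ℝ, ℝ) (fun h : G => f (adAct h a)) 1 T := hf.hasMFDerivAt
  have hker : ∀ η : E, lieBr (E := E) G a.1 η = 0 → T η = 0 := by
    intro η hη
    obtain ⟨γ, hγ0, hγ, hγa⟩ := exists_curve_in_isotropy (E := E) (G := G) a.1 η hη
    have h1 := hasMFDerivAt_comp_of_eq hd hγ hγ0
    have h2 : HasMFDerivAt 𝓘(ℝ, ℝ) 𝓘(ℝ, ℝ) ((fun h : G => f (adAct h a)) ∘ γ) 0
        (0 : ℝ →L[ℝ] ℝ) := by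
      refine (hasMFDerivAt_const (f a) (0 : ℝ)).congr_of_eventuallyEq ?_
      filter_upwards [hγa] with t ht
      exact congrArg f (Subtype.ext ht)
    have h3 := congrArg (fun A : ℝ →L[ℝ] ℝ => A 1) (hasMFDerivAt_unique h1 h2)
    have h4 : T ((1 : ℝ) • η) = 0 := h3
    rwa [one_smul] at h4
  obtain ⟨S, hS⟩ := (adMap (a : Lie E G)).rangeRestrict.exists_rightInverse_of_surjective
    (LinearMap.range_rangeRestrict _)
  let S' : orbitTangent a →ₗ[ℝ] E := S
  -- The sign matches `ad a (-η)` in `HasOrbitGradient`. The choice of the section `S` is harmless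
  -- because `T` vanishes on the kernel of `ad a`.
  refine ⟨-(T.toLinearMap ∘ₗ S'), ?_⟩
  intro (η : E)
  have h1 : (adMap (a : Lie E G)).rangeRestrict (S ((adMap (a : Lie E G)).rangeRestrict (-η))) =
      (adMap (a : Lie E G)).rangeRestrict (-η) := LinearMap.congr_fun hS _
  have h2 : lieBr (E := E) G a.1 (S' ((adMap (a : Lie E G)).rangeRestrict (-η)) + η) = 0 := by
    have h3 := congrArg Subtype.val h1
    have h4 : adMap (a : Lie E G) (S' ((adMap (a : Lie E G)).rangeRestrict (-η)) + η) = 0 := by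
      refine (map_add (adMap (a : Lie E G)) _ _).trans ?_
      change adMap (a : Lie E G) (S _) = adMap (a : Lie E G) (-η) at h3
      refine (congrArg (· + adMap (a : Lie E G) η) h3).trans ?_
      exact (congrArg (· + _) (map_neg (adMap (a : Lie E G)) η)).trans (neg_add_cancel _)
    exact h4
  have h5 := hker _ h2
  rw [map_add] at h5
  exact neg_eq_of_add_eq_zero_right h5

theorem existsUnique_hasOrbitGradient (f : adOrbit ζ → ℝ) (a : adOrbit ζ)
    (hf : MDifferentiableAt 𝓘(ℝ, E) 𝓘(ℝ, ℝ) (fun h : G => f (adAct h a)) 1) :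
    ∃! ν, HasOrbitGradient f a ν := by
  obtain ⟨ν, hν⟩ := exists_hasOrbitGradient f a hf
  refine ⟨ν, hν, fun ν' hν' => LinearMap.ext fun y => ?_⟩
  obtain ⟨η, rfl⟩ := (adMap (a : Lie E G)).surjective_rangeRestrict y
  have h1 := hν (-η)
  have h2 := hν' (-η)
  rw [neg_neg] at h1 h2
  rw [h1, h2]

/-- The bridge from the orbit to the group. The minus sign appears because the left action moves `a`
in the direction `[η, a] = -[a, η]`. -/
theorem coad_orbitGradient (f : adOrbit ζ → ℝ) (g : G)
    (hf : DifferentiableAt ℝ (fun x : E => f (toOrbit ζ (rightParam g x))) (origin E G)) (η : E) :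
    coad (toOrbit ζ g) (orbitGradient f (toOrbit ζ g)) η =
      -fderiv ℝ (fun x : E => f (toOrbit ζ (rightParam g x))) (origin E G) η := by
  have he : (fun h : G => f (adAct h (toOrbit ζ g))) = fun h => f (toOrbit ζ (h * g)) := by
    funext h; rw [adAct_toOrbit]
  have hd : MDifferentiableAt 𝓘(ℝ, E) 𝓘(ℝ, ℝ) (fun h : G => f (adAct h (toOrbit ζ g))) 1 := by
    rw [he]; exact (mdifferentiableAt_one_iff (V := ℝ) _).2 hf
  have hex := exists_hasOrbitGradient f _ hd
  have hν : HasOrbitGradient f (toOrbit ζ g) (orbitGradient f (toOrbit ζ g)) := by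
    rw [orbitGradient, dif_pos hex]; exact hex.choose_spec
  have h1 := hν (-η)
  have hn : (- -η : Lie E G) = η := neg_neg η
  have h0 : coad (toOrbit ζ g) (orbitGradient f (toOrbit ζ g)) η =
      orbitGradient f (toOrbit ζ g) ((adMap (toOrbit ζ g : Lie E G)).rangeRestrict (- -η)) := by
    rw [hn]; rfl
  have h2 := mfderiv_one (E := E) (V := ℝ) (fun h : G => f (adAct h (toOrbit ζ g)))
  refine h0.trans <| h1.trans ((congrArg (fun A : E →L[ℝ] ℝ => A (-η)) h2).trans ?_)
  simp only [map_neg, adAct_toOrbit, rightParam]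

end Gradient

/-! ### Linear symplectic algebra on `𝔤 × 𝔤*` and the reduced bracket. -/

section Symplectic

variable {E : Type*} [NormedAddCommGroup E] [NormedSpace ℝ E] [FiniteDimensional ℝ E]
  {G : Type*} [TopologicalSpace G] [ChartedSpace E G] [Group G] [LieGroup 𝓘(ℝ, E) ∞ G]
  {ζ : Lie E G}

variable (G) in
/-- The canonical symplectic form of `T*G` at a point with momentum `m`, in the right
trivialization. -/
def symplForm (m : E →L[ℝ] ℝ) (u v : E × (E →L[ℝ] ℝ)) : ℝ :=
  v.2 u.1 - u.2 v.1 - m (lieBr G u.1 v.1)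

theorem symplForm_sub_left (m : E →L[ℝ] ℝ) (u u' v : E × (E →L[ℝ] ℝ)) :
    symplForm G m (u - u') v = symplForm G m u v - symplForm G m u' v := by
  have h : lieBr G (u.1 - u'.1) v.1 = lieBr G u.1 v.1 - lieBr G u'.1 v.1 :=
    sub_lie (L := Lie E G) (M := Lie E G) _ _ _
  simp only [symplForm, Prod.fst_sub, Prod.snd_sub, h, map_sub, sub_apply]
  ring

theorem eq_zero_of_symplForm (m : E →L[ℝ] ℝ) (u : E × (E →L[ℝ] ℝ))
    (h : ∀ v, symplForm G m u v = 0) : u = 0 := by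
  have h0 : ∀ w : E, lieBr G w 0 = 0 := fun w => lie_zero (L := Lie E G) (M := Lie E G) w
  have h0' : ∀ w : E, lieBr G 0 w = 0 := fun w => zero_lie (L := Lie E G) (M := Lie E G) w
  have h1 : u.1 = 0 := by
    by_contra hne
    obtain ⟨μ, hμ⟩ := SeparatingDual.exists_ne_zero (R := ℝ) hne
    have h2 := h (0, μ)
    simp [symplForm, h0] at h2
    exact hμ h2
  have h2 : u.2 = 0 := by
    ext w
    have h3 := h (w, 0)
    simpa [symplForm, h1, h0'] using h3
  exact Prod.ext h1 h2

/-- If `A` and `B` pull the symplectic forms back to the same form, the Poisson brackets of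
covectors that correspond under `A` and `B` coincide. -/
theorem apply_hamiltonian_eq {m m' : E →L[ℝ] ℝ} {A B : E × E →L[ℝ] E × (E →L[ℝ] ℝ)}
    (hAB : ∀ u v, symplForm G m' (A u) (A v) = symplForm G m (B u) (B v))
    (hA : Function.Surjective A) (hB : Function.Surjective B)
    {α α' β β' : E × (E →L[ℝ] ℝ) →L[ℝ] ℝ}
    (hα : α'.comp A = α.comp B) (hβ : β'.comp A = β.comp B) {v v' : E × (E →L[ℝ] ℝ)}
    (hv : ∀ u, symplForm G m v u = β u) (hv' : ∀ u, symplForm G m' v' u = β' u) :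
    α' v' = α v := by
  obtain ⟨b, rfl⟩ := hA v'
  -- Writing `v' = A b`, the vectors `B b` and `v` have the same pairing with every `B u`, and these
  -- exhaust the space; nondegeneracy concludes.
  have h1 : B b = v := by
    rw [← sub_eq_zero]
    refine eq_zero_of_symplForm (G := G) m _ fun w => ?_
    obtain ⟨u, rfl⟩ := hB w
    rw [symplForm_sub_left, ← hAB, hv', hv, sub_eq_zero]
    exact congrArg (fun T : E × E →L[ℝ] ℝ => T u) hβ
  rw [← h1]
  exact congrArg (fun T : E × E →L[ℝ] ℝ => T b) hα

theorem finrank_dual_prod :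
    Module.finrank ℝ (E × E) = Module.finrank ℝ (E × (E →L[ℝ] ℝ)) := by
  have h : Module.finrank ℝ (E →L[ℝ] ℝ) = Module.finrank ℝ E := by
    rw [← (LinearMap.toContinuousLinearMap : (E →ₗ[ℝ] ℝ) ≃ₗ[ℝ] (E →L[ℝ] ℝ)).finrank_eq]
    exact Subspace.dual_finrank_eq
  rw [Module.finrank_prod, Module.finrank_prod, h]

theorem surjective_of_injective (A : E × E →L[ℝ] E × (E →L[ℝ] ℝ)) (h : Function.Injective A) :
    Function.Surjective A :=
  (LinearMap.injective_iff_surjective_of_finrank_eq_finrank finrank_dual_prod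
    (f := A.toLinearMap)).1 h

theorem injective_of_surjective (A : E × E →L[ℝ] E × (E →L[ℝ] ℝ)) (h : Function.Surjective A) :
    Function.Injective A :=
  (LinearMap.injective_iff_surjective_of_finrank_eq_finrank finrank_dual_prod
    (f := A.toLinearMap)).2 h

/-- If `B u = 0`, then `A u` is orthogonal to the whole image of `A`, hence zero. So `B` is
injective, and dimensions agree. -/
theorem surjective_of_symplForm_eq {m m' : E →L[ℝ] ℝ} {A B : E × E →L[ℝ] E × (E →L[ℝ] ℝ)}
    (hAB : ∀ u v, symplForm G m' (A u) (A v) = symplForm G m (B u) (B v))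
    (hA : Function.Surjective A) : Function.Surjective B := by
  refine surjective_of_injective B ((injective_iff_map_eq_zero B).2 fun u hu => ?_)
  refine injective_of_surjective A hA ?_
  rw [map_zero]
  refine eq_zero_of_symplForm (G := G) m' _ fun w => ?_
  obtain ⟨v, rfl⟩ := hA w
  have h := zero_lie (L := Lie E G) (M := Lie E G) (B v).1
  change lieBr G (0 : E) (B v).1 = 0 at h
  rw [hAB, hu]
  simp [symplForm, h]

/-- The Poisson bracket on the reduced space is computed by Hamiltonian vectors of the pulled back
functions on `T*G`. -/
theorem exists_poissonBracket_eq (f₁ f₂ : adOrbit ζ × LieDual E → ℝ) (g : G) (m : LieDual E)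
    (h₁ : DifferentiableAt ℝ (fun p : E × (E →L[ℝ] ℝ) =>
      f₁ (toOrbit ζ (rightParam g p.1), p.2)) (origin E G, m))
    (h₂ : DifferentiableAt ℝ (fun p : E × (E →L[ℝ] ℝ) =>
      f₂ (toOrbit ζ (rightParam g p.1), p.2)) (origin E G, m)) :
    ∃ v : E × (E →L[ℝ] ℝ),
      (∀ u, symplForm G m v u = fderiv ℝ (fun p : E × (E →L[ℝ] ℝ) =>
        f₂ (toOrbit ζ (rightParam g p.1), p.2)) (origin E G, m) u) ∧
      poissonBracket f₁ f₂ (toOrbit ζ g, m) = -fderiv ℝ (fun p : E × (E →L[ℝ] ℝ) =>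
        f₁ (toOrbit ζ (rightParam g p.1), p.2)) (origin E G, m) v := by
  have key : ∀ f : adOrbit ζ × LieDual E → ℝ, DifferentiableAt ℝ (fun p : E × (E →L[ℝ] ℝ) =>
      f (toOrbit ζ (rightParam g p.1), p.2)) (origin E G, m) →
      (∀ η : E, coad (toOrbit ζ g) (orbitGradient (fun a => f (a, m)) (toOrbit ζ g)) η =
        -fderiv ℝ (fun p : E × (E →L[ℝ] ℝ) =>
          f (toOrbit ζ (rightParam g p.1), p.2)) (origin E G, m) (η, 0)) ∧
      (∀ μ : E →L[ℝ] ℝ, μ (dualGradient (fun m => f (toOrbit ζ g, m)) m) =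
        fderiv ℝ (fun p : E × (E →L[ℝ] ℝ) =>
          f (toOrbit ζ (rightParam g p.1), p.2)) (origin E G, m) (0, μ)) := by
    intro f hf
    constructor
    · intro η
      have h1 := HasFDerivAt.comp (origin E G) (g := fun p : E × (E →L[ℝ] ℝ) =>
          f (toOrbit ζ (rightParam g p.1), p.2)) (f := fun x : E => (x, m)) hf.hasFDerivAt
          (hasFDerivAt_prodMk_left (origin E G) m)
      rw [coad_orbitGradient (fun a => f (a, m)) g h1.differentiableAt]
      exact congrArg (fun T : E →L[ℝ] ℝ => -T η) h1.fderiv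
    · intro μ
      have h1 := HasFDerivAt.comp m (g := fun p : E × (E →L[ℝ] ℝ) =>
          f (toOrbit ζ (rightParam g p.1), p.2)) (f := fun x : E →L[ℝ] ℝ => (origin E G, x))
          hf.hasFDerivAt (hasFDerivAt_prodMk_right (origin E G) m)
      have h2 : (fun p : E × (E →L[ℝ] ℝ) => f (toOrbit ζ (rightParam g p.1), p.2)) ∘
          (fun x : E →L[ℝ] ℝ => (origin E G, x)) = fun m => f (toOrbit ζ g, m) := by
        funext x; simp only [Function.comp, rightParam_origin]
      rw [h2] at h1
      rw [apply_dualGradient, h1.fderiv]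
      rfl
  obtain ⟨k1, k2⟩ := key f₁ h₁
  obtain ⟨k3, k4⟩ := key f₂ h₂
  set D₁ := fderiv ℝ (fun p : E × (E →L[ℝ] ℝ) =>
        f₁ (toOrbit ζ (rightParam g p.1), p.2)) (origin E G, m)
  set D₂ := fderiv ℝ (fun p : E × (E →L[ℝ] ℝ) =>
        f₂ (toOrbit ζ (rightParam g p.1), p.2)) (origin E G, m)
  set ξ₁ : E := dualGradient (fun m => f₁ (toOrbit ζ g, m)) m with hξ₁
  set ξ₂ : E := dualGradient (fun m => f₂ (toOrbit ζ g, m)) m with hξ₂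
  have hsplit : ∀ (D : E × (E →L[ℝ] ℝ) →L[ℝ] ℝ) u, D u = D (u.1, 0) + D (0, u.2) := by
    intro D u
    rw [← map_add]; simp
  -- The solution of `ω_m(v, ·) = D₂`: covectors `(0, μ)` force the first component `ξ₂`, and
  -- vectors `(w, 0)` then force the second.
  refine ⟨(ξ₂, -m.comp (adCLM G ξ₂) - D₂.comp (ContinuousLinearMap.inl ℝ E (E →L[ℝ] ℝ))), ?_, ?_⟩
  · intro u
    rw [hsplit D₂ u, ← k4]
    simp [symplForm, adCLM_apply]
    ring
  · rw [hsplit D₁, ← k2]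
    have hP : poissonBracket f₁ f₂ (toOrbit ζ g, m) =
        coad (toOrbit ζ g) (orbitGradient (fun a => f₁ (a, m)) (toOrbit ζ g)) ξ₂
        - coad (toOrbit ζ g) (orbitGradient (fun a => f₂ (a, m)) (toOrbit ζ g)) ξ₁
        - m (lieBr G ξ₁ ξ₂) := rfl
    rw [hP, k1, k3, ← neg_lieBr ξ₂ ξ₁]
    simp [adCLM_apply]
    ring

end Symplectic

/-! ### Generating functions and the symplectic form. -/

section Generating

variable {E : Type*} [NormedAddCommGroup E] [NormedSpace ℝ E]
  {G : Type*} [TopologicalSpace G] [ChartedSpace E G] [Group G] [LieGroup 𝓘(ℝ, E) ∞ G]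

variable (G) in
/-- The discrete Legendre transformation `(g, g') ↦ (g', d₂L(g, g'))` in right translated charts,
where `F` is the chart expression of `L`. -/
def legendreChart (F : E × E → ℝ) (p : E × E) : E × (E →L[ℝ] ℝ) :=
  (p.2, ((fderiv ℝ F p).comp (ContinuousLinearMap.inr ℝ E E)).comp (rightDiff G p.2))

variable (G) in
/-- The map `(g, g') ↦ (g, -d₁L(g, g'))` in right translated charts, where `F` is the chart
expression of `L`. -/
def momentumChart (F : E × E → ℝ) (p : E × E) : E × (E →L[ℝ] ℝ) :=
  (p.1, -((fderiv ℝ F p).comp (ContinuousLinearMap.inl ℝ E E)).comp (rightDiff G p.1))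

variable {F : E × E → ℝ}

theorem contDiffAt_legendreChart (hF : ContDiffAt ℝ ∞ F (origin E G, origin E G)) :
    ContDiffAt ℝ ∞ (legendreChart G F) (origin E G, origin E G) := by
  have h1 : ContDiffAt ℝ ∞ (fderiv ℝ F) (origin E G, origin E G) := hF.fderiv_right (by simp)
  have h2 : ContDiffAt ℝ ∞ (fun p : E × E => rightDiff G p.2) (origin E G, origin E G) :=
    ContDiffAt.comp (origin E G, origin E G) (g := rightDiff G) contDiffAt_rightDiff contDiffAt_snd
  exact contDiffAt_snd.prodMk ((h1.clm_comp contDiffAt_const).clm_comp h2)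

theorem contDiffAt_momentumChart (hF : ContDiffAt ℝ ∞ F (origin E G, origin E G)) :
    ContDiffAt ℝ ∞ (momentumChart G F) (origin E G, origin E G) := by
  have h1 : ContDiffAt ℝ ∞ (fderiv ℝ F) (origin E G, origin E G) := hF.fderiv_right (by simp)
  have h2 : ContDiffAt ℝ ∞ (fun p : E × E => rightDiff G p.1) (origin E G, origin E G) :=
    ContDiffAt.comp (origin E G, origin E G) (g := rightDiff G) contDiffAt_rightDiff contDiffAt_fst
  exact contDiffAt_fst.prodMk ((h1.clm_comp contDiffAt_const).clm_comp h2).neg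

theorem fderiv_legendreChart (hF : ContDiffAt ℝ ∞ F (origin E G, origin E G)) (u : E × E) :
    fderiv ℝ (legendreChart G F) (origin E G, origin E G) u =
      (u.2, (fderiv ℝ (fderiv ℝ F) (origin E G, origin E G) u).comp
          (ContinuousLinearMap.inr ℝ E E) +
        ((fderiv ℝ F (origin E G, origin E G)).comp (ContinuousLinearMap.inr ℝ E E)).comp
          (fderiv ℝ (rightDiff G) (origin E G) u.2)) := by
  have h1 : ContDiffAt ℝ ∞ (fderiv ℝ F) (origin E G, origin E G) := hF.fderiv_right (by simp)
  have h2 := (h1.differentiableAt (by simp)).hasFDerivAt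
  have h3 := HasFDerivAt.comp (origin E G, origin E G) (g := rightDiff G)
    (f := fun p : E × E => p.2)
    ((contDiffAt_rightDiff (E := E) (G := G)).differentiableAt (by simp)).hasFDerivAt hasFDerivAt_snd
  have h4 := (h2.clm_comp (hasFDerivAt_const (ContinuousLinearMap.inr ℝ E E) _)).clm_comp h3
  have h5 : fderiv ℝ (legendreChart G F) (origin E G, origin E G) = _ :=
    (hasFDerivAt_snd.prodMk h4).fderiv
  rw [h5]
  ext v <;> simp [rightDiff_origin, add_comm]

theorem fderiv_momentumChart (hF : ContDiffAt ℝ ∞ F (origin E G, origin E G)) (u : E × E) :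
    fderiv ℝ (momentumChart G F) (origin E G, origin E G) u =
      (u.1, -((fderiv ℝ (fderiv ℝ F) (origin E G, origin E G) u).comp
          (ContinuousLinearMap.inl ℝ E E) +
        ((fderiv ℝ F (origin E G, origin E G)).comp (ContinuousLinearMap.inl ℝ E E)).comp
          (fderiv ℝ (rightDiff G) (origin E G) u.1))) := by
  have h1 : ContDiffAt ℝ ∞ (fderiv ℝ F) (origin E G, origin E G) := hF.fderiv_right (by simp)
  have h2 := (h1.differentiableAt (by simp)).hasFDerivAt
  have h3 := HasFDerivAt.comp (origin E G, origin E G) (g := rightDiff G)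
    (f := fun p : E × E => p.1)
    ((contDiffAt_rightDiff (E := E) (G := G)).differentiableAt (by simp)).hasFDerivAt hasFDerivAt_fst
  have h4 := (h2.clm_comp (hasFDerivAt_const (ContinuousLinearMap.inl ℝ E E) _)).clm_comp h3
  have h5 : fderiv ℝ (momentumChart G F) (origin E G, origin E G) = _ :=
    (hasFDerivAt_fst.prodMk h4.neg).fderiv
  rw [h5]
  ext v <;> simp [rightDiff_origin, add_comm]

/-- The two maps defined by a generating function pull the symplectic form back to the same
form. -/
theorem symplForm_legendreChart_eq (hF : ContDiffAt ℝ ∞ F (origin E G, origin E G))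
    (u v : E × E) :
    symplForm G (legendreChart G F (origin E G, origin E G)).2
      (fderiv ℝ (legendreChart G F) (origin E G, origin E G) u)
      (fderiv ℝ (legendreChart G F) (origin E G, origin E G) v) =
    symplForm G (momentumChart G F (origin E G, origin E G)).2
      (fderiv ℝ (momentumChart G F) (origin E G, origin E G) u)
      (fderiv ℝ (momentumChart G F) (origin E G, origin E G) v) := by
  have hsymm : fderiv ℝ (fderiv ℝ F) (origin E G, origin E G) u v =
      fderiv ℝ (fderiv ℝ F) (origin E G, origin E G) v u := by
    have h : ContDiffAt ℝ 2 F (origin E G, origin E G) := hF.of_le (WithTop.coe_le_coe.2 le_top)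
    exact (h.isSymmSndFDerivAt (by simp)).eq _ _
  have hsplit : ∀ (D : E × E →L[ℝ] ℝ) (u : E × E), D u = D (u.1, 0) + D (0, u.2) := by
    intro D u
    rw [← map_add]; simp
  rw [hsplit _ v, hsplit _ u] at hsymm
  have hsub : ∀ (D : E × E →L[ℝ] ℝ) (x y : E), D (x - y, 0) = D (x, 0) - D (y, 0) := by
    intro D x y; rw [← map_sub]; simp
  have hsub' : ∀ (D : E × E →L[ℝ] ℝ) (x y : E), D (0, x - y) = D (0, x) - D (0, y) := by
    intro D x y; rw [← map_sub]; simp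
  -- On each side the derivatives of `rightDiff` cancel against the bracket term of the form. What
  -- remains is the symmetry of the second derivative of `F`, split into its two arguments.
  rw [fderiv_legendreChart hF, fderiv_legendreChart hF, fderiv_momentumChart hF,
    fderiv_momentumChart hF]
  simp only [symplForm, legendreChart, momentumChart, lieBr_eq_rightDiff, rightDiff_origin,
    ContinuousLinearMap.comp_id, ContinuousLinearMap.comp_apply, add_apply,
    neg_apply, ContinuousLinearMap.inl_apply, ContinuousLinearMap.inr_apply, hsub, hsub']
  linarith

theorem exists_smooth_localInverse {E₁ E₂ : Type*} [NormedAddCommGroup E₁] [NormedSpace ℝ E₁]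
    [FiniteDimensional ℝ E₁] [NormedAddCommGroup E₂] [NormedSpace ℝ E₂]
    {θ : E₁ → E₂} {p : E₁} (hθ : ContDiffAt ℝ ∞ θ p)
    (hb : Function.Bijective (fderiv ℝ θ p)) :
    ∃ σ : E₂ → E₁, ContDiffAt ℝ ∞ σ (θ p) ∧ σ (θ p) = p ∧
      (∀ᶠ q in 𝓝 (θ p), θ (σ q) = q) ∧ ∀ᶠ x in 𝓝 p, σ (θ x) = x := by
  let e : E₁ ≃L[ℝ] E₂ := (LinearEquiv.ofBijective (fderiv ℝ θ p).toLinearMap hb).toContinuousLinearEquiv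
  have he : (e : E₁ →L[ℝ] E₂) = fderiv ℝ θ p := by ext; rfl
  have hd : HasFDerivAt θ (e : E₁ →L[ℝ] E₂) p := by
    rw [he]; exact (hθ.differentiableAt (by simp)).hasFDerivAt
  have hn : (∞ : WithTop ℕ∞) ≠ 0 := by simp
  refine ⟨hθ.localInverse hd hn, hθ.to_localInverse hd hn, hθ.localInverse_apply_image hd hn, ?_, ?_⟩
  · exact (hθ.hasStrictFDerivAt' hd hn).eventually_right_inverse
  · exact (hθ.hasStrictFDerivAt' hd hn).eventually_left_inverse

end Generating

/-! ### The two partial Lie derivatives of the Lagrangian. -/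

section Lagrangian

variable {E : Type*} [NormedAddCommGroup E] [NormedSpace ℝ E]
  {G : Type*} [TopologicalSpace G] [ChartedSpace E G] [Group G] [LieGroup 𝓘(ℝ, E) ∞ G]
  {L : G → G → ℝ}

/-- The Lie derivative of `L` with respect to the first argument. -/
def lieDeriv₁ (L : G → G → ℝ) (g g' : G) : E →L[ℝ] ℝ := lieDeriv (fun h => L h g') g

/-- The Lie derivative of `L` with respect to the second argument. -/
def lieDeriv₂ (L : G → G → ℝ) (g g' : G) : E →L[ℝ] ℝ := lieDeriv (fun h => L g h) g'

/-- The chart expression of `L` near `(g, g')`. -/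
def lagrangianChart (L : G → G → ℝ) (g g' : G) (p : E × E) : ℝ :=
  L (rightParam g p.1) (rightParam g' p.2)

theorem contDiffAt_lagrangianChart
    (hL : ContMDiff (𝓘(ℝ, E).prod 𝓘(ℝ, E)) 𝓘(ℝ, ℝ) ∞ (fun q : G × G => L q.1 q.2)) (g g' : G) :
    ContDiffAt ℝ ∞ (lagrangianChart L g g') (origin E G, origin E G) :=
  contMDiffAt_prod_rightParam_comp₂.1 (hL (g, g'))

theorem eventually_differentiableAt_lagrangianChart
    (hL : ContMDiff (𝓘(ℝ, E).prod 𝓘(ℝ, E)) 𝓘(ℝ, ℝ) ∞ (fun q : G × G => L q.1 q.2)) (g g' : G) :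
    ∀ᶠ p in 𝓝 (origin E G, origin E G), DifferentiableAt ℝ (lagrangianChart L g g') p := by
  have h : ContDiffAt ℝ 1 (lagrangianChart L g g') (origin E G, origin E G) :=
    (contDiffAt_lagrangianChart hL g g').of_le (by exact_mod_cast le_top)
  filter_upwards [h.eventually (by simp)] with p hp
  exact hp.differentiableAt one_ne_zero

theorem lieDeriv₂_rightParam
    (hL : ContMDiff (𝓘(ℝ, E).prod 𝓘(ℝ, E)) 𝓘(ℝ, ℝ) ∞ (fun q : G × G => L q.1 q.2)) (g g' : G) :
    ∀ᶠ p in 𝓝 (origin E G, origin E G), lieDeriv₂ L (rightParam g p.1) (rightParam g' p.2) =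
      (legendreChart G (lagrangianChart L g g') p).2 := by
  have h2 := continuousAt_snd.tendsto (x := (origin E G, origin E G)) |>.eventually
    (lieDeriv_rightParam (E := E) (G := G))
  filter_upwards [h2, eventually_differentiableAt_lagrangianChart hL g g'] with p hp hd
  have h3 := HasFDerivAt.comp p.2 (g := lagrangianChart L g g') (f := fun y : E => (p.1, y))
    hd.hasFDerivAt (hasFDerivAt_prodMk_right p.1 p.2)
  refine (hp (fun h => L (rightParam g p.1) h) g' h3.differentiableAt).trans ?_
  exact congrArg (fun A : E →L[ℝ] ℝ => A.comp (rightDiff G p.2)) h3.fderiv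

theorem lieDeriv₁_rightParam
    (hL : ContMDiff (𝓘(ℝ, E).prod 𝓘(ℝ, E)) 𝓘(ℝ, ℝ) ∞ (fun q : G × G => L q.1 q.2)) (g g' : G) :
    ∀ᶠ p in 𝓝 (origin E G, origin E G), -lieDeriv₁ L (rightParam g p.1) (rightParam g' p.2) =
      (momentumChart G (lagrangianChart L g g') p).2 := by
  have h2 := continuousAt_fst.tendsto (x := (origin E G, origin E G)) |>.eventually
    (lieDeriv_rightParam (E := E) (G := G))
  filter_upwards [h2, eventually_differentiableAt_lagrangianChart hL g g'] with p hp hd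
  have h3 := HasFDerivAt.comp p.1 (g := lagrangianChart L g g') (f := fun x : E => (x, p.2))
    hd.hasFDerivAt (hasFDerivAt_prodMk_left p.1 p.2)
  have h4 := hp (fun h => L h (rightParam g' p.2)) g h3.differentiableAt
  refine congrArg (- ·) (h4.trans ?_)
  exact congrArg (fun A : E →L[ℝ] ℝ => A.comp (rightDiff G p.1)) h3.fderiv

theorem lieDeriv₂_eq
    (hL : ContMDiff (𝓘(ℝ, E).prod 𝓘(ℝ, E)) 𝓘(ℝ, ℝ) ∞ (fun q : G × G => L q.1 q.2)) (g g' : G) :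
    lieDeriv₂ L g g' = (legendreChart G (lagrangianChart L g g') (origin E G, origin E G)).2 := by
  have h := (lieDeriv₂_rightParam hL g g').self_of_nhds
  rwa [rightParam_origin, rightParam_origin] at h

theorem neg_lieDeriv₁_eq
    (hL : ContMDiff (𝓘(ℝ, E).prod 𝓘(ℝ, E)) 𝓘(ℝ, ℝ) ∞ (fun q : G × G => L q.1 q.2)) (g g' : G) :
    -lieDeriv₁ L g g' = (momentumChart G (lagrangianChart L g g') (origin E G, origin E G)).2 := by
  have h := (lieDeriv₁_rightParam hL g g').self_of_nhds
  rwa [rightParam_origin, rightParam_origin] at h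

theorem contMDiff_neg_lieDeriv₁
    (hL : ContMDiff (𝓘(ℝ, E).prod 𝓘(ℝ, E)) 𝓘(ℝ, ℝ) ∞ (fun q : G × G => L q.1 q.2)) :
    ContMDiff (𝓘(ℝ, E).prod 𝓘(ℝ, E)) 𝓘(ℝ, E →L[ℝ] ℝ) ∞
      (fun q : G × G => (-lieDeriv₁ L q.1 q.2 : E →L[ℝ] ℝ)) := by
  rintro ⟨g, g'⟩
  rw [contMDiffAt_prod_rightParam_comp₂]
  exact (contDiffAt_momentumChart (contDiffAt_lagrangianChart hL g g')).snd.congr_of_eventuallyEq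
    (lieDeriv₁_rightParam hL g g')

end Lagrangian

/-! ### Lifting the reduced equations to the group. -/

section Reduction

variable {E : Type*} [NormedAddCommGroup E] [NormedSpace ℝ E]
  {G : Type*} [TopologicalSpace G] [ChartedSpace E G] [Group G] [LieGroup 𝓘(ℝ, E) ∞ G]
  {L : G → G → ℝ} {ζ : Lie E G} {Λ : adOrbit ζ × G → ℝ}

theorem adOp_mul_apply (g h : G) (v : E) : adOp E (g * h) v = adOp E g (adOp E h v) := by
  rw [adOp_mul]; rfl

/-- The chosen representative and `g` differ by a right factor in the isotropy group. -/
theorem reducedLagrangian_toOrbit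
    (hinv : ∀ g w : G, ∀ h ∈ isotropy ζ,
      rightTrivialization L (g * h) w = rightTrivialization L g w) (g w : G) :
    reducedLagrangian ζ (rightTrivialization L) (toOrbit ζ g, w) = rightTrivialization L g w := by
  have hc := Classical.choose_spec (toOrbit ζ g).2
  set k : G := Classical.choose (toOrbit ζ g).2 with hk
  have hc' : adOp E k ζ = adOp E g ζ := hc
  have h1 : g⁻¹ * k ∈ isotropy ζ := by
    have h : adOp E (g⁻¹ * k) ζ = ζ :=
      (adOp_mul_apply _ _ _).trans ((congrArg (adOp E g⁻¹) hc').trans (adOp_inv_apply g _))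
    exact h
  have h2 := hinv g w _ h1
  rw [mul_inv_cancel_left] at h2
  exact h2

/-- No `Ad` enters: the variation `h w` of `w` turns `w g` into `h (w g)`. -/
theorem legendre_toOrbit (hΛ : ∀ g w : G, Λ (toOrbit ζ g, w) = L g (w * g)) (g w : G) :
    legendre Λ (toOrbit ζ g, w) = (toOrbit ζ (w * g), lieDeriv₂ L g (w * g)) := by
  refine Prod.ext (Subtype.ext (Ad_mul w g ζ).symm) ?_
  refine (lieDeriv_eq_fderiv (E := E) (fun v => Λ (toOrbit ζ g, v)) w).trans
    (Eq.trans ?_ (lieDeriv_eq_fderiv (E := E) (fun h => L g h) (w * g)).symm)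
  exact congrArg (fun f : E → ℝ => fderiv ℝ f (origin E G)) (funext fun x => by
    rw [hΛ, rightParam, rightParam, mul_assoc])

theorem hasFDerivAt_conj_chart (w : G) : HasFDerivAt
    (fun x : E => extChartAt 𝓘(ℝ, E) (1 : G) (w * (extChartAt 𝓘(ℝ, E) (1 : G)).symm x * w⁻¹))
    (adOp E w) (origin E G) := by
  have h1 : HasMFDerivAt 𝓘(ℝ, E) 𝓘(ℝ, E) (extChartAt 𝓘(ℝ, E) (1 : G)) 1
      (ContinuousLinearMap.id ℝ E) := by
    have h : HasMFDerivAt 𝓘(ℝ, E) 𝓘(ℝ, E) (extChartAt 𝓘(ℝ, E) (1 : G)) 1 _ :=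
      ((contMDiffAt_extChartAt (n := ∞)).mdifferentiableAt (by simp)).hasMFDerivAt
    exact h.congr_mfderiv mfderiv_extChartAt_self
  have h2 := hasMFDerivAt_comp_of_eq h1 (hasMFDerivAt_conj (E := E) w) (by simp)
  have h3 := h2.mdifferentiableAt
  have h4 := (mdifferentiableAt_one_iff (V := E) _).1 h3
  have h5 := mfderiv_one (E := E) (V := E)
    (extChartAt 𝓘(ℝ, E) (1 : G) ∘ fun h : G => w * h * w⁻¹)
  have h6 := h4.hasFDerivAt
  have h7 : (mfderiv 𝓘(ℝ, E) 𝓘(ℝ, E) (extChartAt 𝓘(ℝ, E) (1 : G) ∘ fun h : G => w * h * w⁻¹) 1 :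
      E →L[ℝ] E) = adOp E w := h2.mfderiv
  rw [← h5, h7] at h6
  exact h6

variable [FiniteDimensional ℝ E]

/-- At fixed `w`, replacing `g` by `h g` replaces `w g` by `(w h w⁻¹) w g`, so the second argument
of `L` moves with velocity `Ad w η`. -/
theorem coad_orbitGradient_reduced
    (hL : ContMDiff (𝓘(ℝ, E).prod 𝓘(ℝ, E)) 𝓘(ℝ, ℝ) ∞ (fun q : G × G => L q.1 q.2))
    (hΛ : ∀ g w : G, Λ (toOrbit ζ g, w) = L g (w * g)) (g w : G) :
    coad (toOrbit ζ g) (orbitGradient (fun b => Λ (b, w)) (toOrbit ζ g)) =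
      -(lieDeriv₁ L g (w * g) + (lieDeriv₂ L g (w * g)).comp (adOp E w)) := by
  set F := lagrangianChart (E := E) L g (w * g) with hF
  have hd : DifferentiableAt ℝ F (origin E G, origin E G) :=
    (contDiffAt_lagrangianChart hL g (w * g)).differentiableAt (by simp)
  have hc := hasFDerivAt_conj_chart (E := E) w
  have ho : extChartAt 𝓘(ℝ, E) (1 : G) (w * (extChartAt 𝓘(ℝ, E) (1 : G)).symm (origin E G) * w⁻¹) =
      origin E G := by
    rw [symm_origin, mul_one, mul_inv_cancel]; rfl
  have h1 : HasFDerivAt (F ∘ fun x : E => (x, extChartAt 𝓘(ℝ, E) (1 : G)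
      (w * (extChartAt 𝓘(ℝ, E) (1 : G)).symm x * w⁻¹)))
      ((fderiv ℝ F (origin E G, origin E G)).comp
        ((ContinuousLinearMap.id ℝ E).prod (adOp E w))) (origin E G) := by
    refine HasFDerivAt.comp (origin E G) ?_ ((hasFDerivAt_id _).prodMk hc)
    change HasFDerivAt F _ (origin E G, extChartAt 𝓘(ℝ, E) (1 : G) (w *
      (extChartAt 𝓘(ℝ, E) (1 : G)).symm (origin E G) * w⁻¹))
    rw [ho]; exact hd.hasFDerivAt
  have h2 : (fun x : E => Λ (toOrbit ζ (rightParam g x), w)) =ᶠ[𝓝 (origin E G)]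
      F ∘ fun x : E => (x, extChartAt 𝓘(ℝ, E) (1 : G)
        (w * (extChartAt 𝓘(ℝ, E) (1 : G)).symm x * w⁻¹)) := by
    have hk : ContinuousAt
        (fun x : E => w * (extChartAt 𝓘(ℝ, E) (1 : G)).symm x * w⁻¹) (origin E G) :=
      ContinuousAt.comp (g := fun h : G => w * h * w⁻¹)
        (contMDiff_conj (E := E) w).continuous.continuousAt contMDiffAt_symm_origin.continuousAt
    have hs := hk.tendsto.eventually (p := fun k => k ∈ (extChartAt 𝓘(ℝ, E) (1 : G)).source) (by
      rw [symm_origin, mul_one, mul_inv_cancel]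
      exact extChartAt_source_mem_nhds (I := 𝓘(ℝ, E)) (1 : G))
    filter_upwards [hs] with x hx
    simp only [Function.comp, hF, lagrangianChart, hΛ, rightParam]
    rw [(extChartAt 𝓘(ℝ, E) (1 : G)).left_inv hx]
    simp [mul_assoc]
  have h3 := h1.congr_of_eventuallyEq h2
  ext η
  refine (coad_orbitGradient (fun b => Λ (b, w)) g h3.differentiableAt η).trans ?_
  have e1 : lieDeriv₁ L g (w * g) = (fderiv ℝ F (origin E G, origin E G)).comp
      (ContinuousLinearMap.inl ℝ E E) := by
    have := neg_lieDeriv₁_eq (E := E) hL g (w * g)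
    rw [momentumChart, neg_inj] at this
    rw [this, rightDiff_origin, ContinuousLinearMap.comp_id]
  have e2 : lieDeriv₂ L g (w * g) = (fderiv ℝ F (origin E G, origin E G)).comp
      (ContinuousLinearMap.inr ℝ E E) := by
    have := lieDeriv₂_eq (E := E) hL g (w * g)
    rw [legendreChart] at this
    rw [this, rightDiff_origin, ContinuousLinearMap.comp_id]
  rw [h3.fderiv, e1, e2]
  simp only [ContinuousLinearMap.comp_apply, neg_apply, add_apply,
    ContinuousLinearMap.inl_apply, ContinuousLinearMap.inr_apply, ContinuousLinearMap.prod_apply,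
    ContinuousLinearMap.id_apply]
  rw [← map_add]; simp

theorem sub_coad_orbitGradient_reduced
    (hL : ContMDiff (𝓘(ℝ, E).prod 𝓘(ℝ, E)) 𝓘(ℝ, ℝ) ∞ (fun q : G × G => L q.1 q.2))
    (hΛ : ∀ g w : G, Λ (toOrbit ζ g, w) = L g (w * g)) (g w : G) :
    coAd w (lieDeriv₂ (E := E) L g (w * g)) +
      coad (toOrbit ζ g) (orbitGradient (fun b => Λ (b, w)) (toOrbit ζ g)) =
      -lieDeriv₁ L g (w * g) := by
  rw [coad_orbitGradient_reduced hL hΛ]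
  change (lieDeriv₂ L g (w * g)).comp (adOp E w) + _ = _
  abel

/-- The `Ad* w` terms cancel, which leaves the unreduced discrete momentum `-d₁L`. -/
theorem momentumEquation_iff
    (hL : ContMDiff (𝓘(ℝ, E).prod 𝓘(ℝ, E)) 𝓘(ℝ, ℝ) ∞ (fun q : G × G => L q.1 q.2))
    (hΛ : ∀ g w : G, Λ (toOrbit ζ g, w) = L g (w * g)) (g w : G) (m : LieDual E) :
    MomentumEquation Λ (toOrbit ζ g) w m (lieDeriv₂ L g (w * g)) ↔
      m = -lieDeriv₁ L g (w * g) := by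
  rw [MomentumEquation, ← sub_coad_orbitGradient_reduced hL hΛ g w, eq_sub_iff_add_eq, eq_comm]

/-- Any lift `g` of `a` may be prescribed; `w` and the lift `g' = w g` of `a'` then determine each
other. -/
theorem step_toOrbit_iff
    (hL : ContMDiff (𝓘(ℝ, E).prod 𝓘(ℝ, E)) 𝓘(ℝ, ℝ) ∞ (fun q : G × G => L q.1 q.2))
    (hΛ : ∀ g w : G, Λ (toOrbit ζ g, w) = L g (w * g)) (U : Set (adOrbit ζ × G)) (g : G)
    (m : LieDual E) (p' : adOrbit ζ × LieDual E) :
    Step Λ U (toOrbit ζ g, m) p' ↔ ∃ g' : G, (toOrbit ζ g, g' * g⁻¹) ∈ U ∧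
      m = -lieDeriv₁ L g g' ∧ p' = (toOrbit ζ g', lieDeriv₂ L g g') := by
  constructor
  · rintro ⟨w, hw, hp', hm⟩
    refine ⟨w * g, by simpa using hw, ?_, ?_⟩
    · rw [hp', legendre_toOrbit hΛ] at hm
      exact (momentumEquation_iff hL hΛ g w m).1 hm
    · rw [hp', legendre_toOrbit hΛ]
  · rintro ⟨g', hU, hm, hp'⟩
    have hg : g' * g⁻¹ * g = g' := by simp
    refine ⟨g' * g⁻¹, hU, ?_, ?_⟩
    · rw [legendre_toOrbit hΛ, hg, hp']
    · rw [hp']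
      have h := (momentumEquation_iff hL hΛ g (g' * g⁻¹) m).2
      rw [hg] at h
      exact h hm

theorem legendre_mem_image_iff (hΛ : ∀ g w : G, Λ (toOrbit ζ g, w) = L g (w * g))
    (U : Set (adOrbit ζ × G)) (g' : G) (m' : LieDual E) :
    (toOrbit ζ g', m') ∈ legendre Λ '' U ↔
      ∃ g : G, (toOrbit ζ g, g' * g⁻¹) ∈ U ∧ m' = lieDeriv₂ L g g' := by
  constructor
  · rintro ⟨⟨a, w⟩, hU, hx⟩
    obtain ⟨k, rfl⟩ := exists_toOrbit_eq a
    -- Here the lift `g'` of the end point is prescribed, so the representative `k` of `a` is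
    -- exchanged for `w⁻¹ g'`.
    have ha : toOrbit ζ (w⁻¹ * g') = toOrbit ζ k := by
      have h1 : adOp E (w * k) ζ = adOp E g' ζ :=
        congrArg (fun q : adOrbit ζ × LieDual E => (q.1 : Lie E G))
          ((legendre_toOrbit hΛ k w).symm.trans hx)
      refine Subtype.ext ?_
      change adOp E (w⁻¹ * g') ζ = adOp E k ζ
      have h2 := (adOp_mul_apply (E := E) w k ζ).symm.trans h1
      exact (adOp_mul_apply _ _ _).trans
        ((congrArg (adOp E w⁻¹) h2.symm).trans (adOp_inv_apply w _))
    rw [← ha] at hU hx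
    refine ⟨w⁻¹ * g', by simpa using hU, ?_⟩
    rw [legendre_toOrbit hΛ] at hx
    have h2 := congrArg Prod.snd hx
    simp only [mul_inv_cancel_left] at h2
    exact h2.symm
  · rintro ⟨g, hU, hm⟩
    refine ⟨_, hU, ?_⟩
    rw [legendre_toOrbit hΛ, hm]
    simp

end Reduction

/-! ### Discrete Euler-Lagrange equations and their reduction. -/

section Extremal

variable {E : Type*} [NormedAddCommGroup E] [NormedSpace ℝ E]
  {G : Type*} [TopologicalSpace G] [ChartedSpace E G] [Group G] [LieGroup 𝓘(ℝ, E) ∞ G]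
  {L : G → G → ℝ}

theorem hasDerivAt_lagrangian
    (hL : ContMDiff (𝓘(ℝ, E).prod 𝓘(ℝ, E)) 𝓘(ℝ, ℝ) ∞ (fun q : G × G => L q.1 q.2))
    {γ γ' : ℝ → G} (hγ : ContMDiffAt 𝓘(ℝ, ℝ) 𝓘(ℝ, E) ∞ γ 0)
    (hγ' : ContMDiffAt 𝓘(ℝ, ℝ) 𝓘(ℝ, E) ∞ γ' 0) :
    HasDerivAt (fun ε => L (γ ε) (γ' ε))
      (lieDeriv₁ L (γ 0) (γ' 0) (deriv (fun ε => (rightChart (γ 0) (γ ε) : E)) 0) +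
        lieDeriv₂ L (γ 0) (γ' 0) (deriv (fun ε => (rightChart (γ' 0) (γ' ε) : E)) 0)) 0 := by
  set F := lagrangianChart (E := E) L (γ 0) (γ' 0) with hF
  have hd : DifferentiableAt ℝ F (origin E G, origin E G) :=
    (contDiffAt_lagrangianChart hL _ _).differentiableAt (by simp)
  have hx : ∀ c : ℝ → G, ContMDiffAt 𝓘(ℝ, ℝ) 𝓘(ℝ, E) ∞ c 0 →
      HasDerivAt (fun ε => (rightChart (c 0) (c ε) : E))
        (deriv (fun ε => (rightChart (c 0) (c ε) : E)) 0) 0 ∧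
      ∀ᶠ ε in 𝓝 0, rightParam (c 0) (rightChart (c 0) (c ε) : E) = c ε := by
    intro c hc
    refine ⟨DifferentiableAt.hasDerivAt ?_, ?_⟩
    · have h := ContMDiffAt.comp (0 : ℝ) (contMDiffAt_rightChart (E := E) (c 0)) hc
      exact (contMDiffAt_iff_contDiffAt.1 h).differentiableAt (by simp)
    · exact hc.continuousAt.tendsto.eventually (rightParam_rightChart (E := E) (c 0))
  obtain ⟨h1, h2⟩ := hx γ hγ
  obtain ⟨h3, h4⟩ := hx γ' hγ'
  have e0 : (F ∘ fun ε => ((rightChart (γ 0) (γ ε) : E), (rightChart (γ' 0) (γ' ε) : E))) =ᶠ[𝓝 0]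
      fun ε => L (γ ε) (γ' ε) := by
    filter_upwards [h2, h4] with ε k1 k2
    simp only [Function.comp, hF, lagrangianChart, k1, k2]
  have h5 : HasDerivAt
      (F ∘ fun ε => ((rightChart (γ 0) (γ ε) : E), (rightChart (γ' 0) (γ' ε) : E)))
      (fderiv ℝ F (origin E G, origin E G)
        (deriv (fun ε => (rightChart (γ 0) (γ ε) : E)) 0,
          deriv (fun ε => (rightChart (γ' 0) (γ' ε) : E)) 0)) 0 := by
    refine HasFDerivAt.comp_hasDerivAt (0 : ℝ) ?_ (h1.prodMk h3)
    rw [rightChart_self, rightChart_self]; exact hd.hasFDerivAt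
  have h6 := h5.congr_of_eventuallyEq e0.symm
  have e1 : lieDeriv₁ L (γ 0) (γ' 0) = (fderiv ℝ F (origin E G, origin E G)).comp
      (ContinuousLinearMap.inl ℝ E E) := by
    have := neg_lieDeriv₁_eq (E := E) hL (γ 0) (γ' 0)
    rw [momentumChart, neg_inj] at this
    rw [this, rightDiff_origin, ContinuousLinearMap.comp_id]
  have e2 : lieDeriv₂ L (γ 0) (γ' 0) = (fderiv ℝ F (origin E G, origin E G)).comp
      (ContinuousLinearMap.inr ℝ E E) := by
    have := lieDeriv₂_eq (E := E) hL (γ 0) (γ' 0)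
    rw [legendreChart] at this
    rw [this, rightDiff_origin, ContinuousLinearMap.comp_id]
  rw [e1, e2]
  refine h6.congr_deriv ?_
  change _ = fderiv ℝ F (origin E G, origin E G) (_, 0) + fderiv ℝ F (origin E G, origin E G) (0, _)
  rw [← map_add]; simp

/-- Summation by parts: it collects at each interior site the contributions of the two neighbouring
terms of the action. -/
theorem sum_shift {k₀ k₁ : ℤ} (hk : k₀ < k₁) (A B : ℤ → ℝ) (hA : A k₀ = 0) (hB : B k₁ = 0) :
    ∑ k ∈ Finset.Ico k₀ k₁, (A k + B (k + 1)) = ∑ k ∈ Finset.Ioo k₀ k₁, (A k + B k) := by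
  rw [Finset.sum_add_distrib, Finset.sum_add_distrib]
  congr 1
  · rw [← Finset.Ioo_insert_left hk, Finset.sum_insert (by simp), hA, zero_add]
  · have h : Finset.Ioc k₀ k₁ = (Finset.Ico k₀ k₁).map (addRightEmbedding 1) := by
      ext x; simp only [Finset.mem_Ioc, Finset.mem_map, Finset.mem_Ico, addRightEmbedding_apply]
      constructor
      · intro h; exact ⟨x - 1, by omega, by omega⟩
      · rintro ⟨y, h, rfl⟩; omega
    have h2 : ∑ k ∈ Finset.Ioc k₀ k₁, B k = ∑ k ∈ Finset.Ico k₀ k₁, B (k + 1) := by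
      rw [h, Finset.sum_map]; rfl
    rw [← h2, ← Finset.Ioo_insert_right hk, Finset.sum_insert (by simp), hB, zero_add]

theorem hasDerivAt_discreteAction
    (hL : ContMDiff (𝓘(ℝ, E).prod 𝓘(ℝ, E)) 𝓘(ℝ, ℝ) ∞ (fun q : G × G => L q.1 q.2))
    {k₀ k₁ : ℤ} {g : ℤ → G} {γ : ℝ → ℤ → G} (h0 : γ 0 = g)
    (hγ : ∀ k, ContMDiffAt 𝓘(ℝ, ℝ) 𝓘(ℝ, E) ∞ (fun ε => γ ε k) 0)
    (hfix : ∀ ε, γ ε k₀ = g k₀ ∧ γ ε k₁ = g k₁) :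
    HasDerivAt (fun ε => discreteAction L k₀ k₁ (γ ε))
      (∑ k ∈ Finset.Ioo k₀ k₁, (lieDeriv₂ L (g (k - 1)) (g k) + lieDeriv₁ L (g k) (g (k + 1)) : E →L[ℝ] ℝ)
        (deriv (fun ε => (rightChart (g k) (γ ε k) : E)) 0)) 0 := by
  -- For `k₁ ≤ k₀` both sums are empty; `sum_shift` needs the strict inequality.
  rcases le_or_gt k₁ k₀ with hk | hk
  · simp only [discreteAction, Finset.Ico_eq_empty_of_le hk, Finset.Ioo_eq_empty_of_le hk,
      Finset.sum_empty]
    exact hasDerivAt_const _ _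
  set x : ℤ → E := fun k => deriv (fun ε => (rightChart (g k) (γ ε k) : E)) 0 with hx
  have h1 : HasDerivAt (fun ε => discreteAction L k₀ k₁ (γ ε))
      (∑ k ∈ Finset.Ico k₀ k₁, (lieDeriv₁ L (g k) (g (k + 1)) (x k) +
        lieDeriv₂ L (g (k + 1 - 1)) (g (k + 1)) (x (k + 1)))) 0 := by
    refine HasDerivAt.fun_sum fun k _ => ?_
    have h := hasDerivAt_lagrangian hL (hγ k) (hγ (k + 1))
    rw [h0] at h
    rw [add_sub_cancel_right]
    exact h
  have hxc : ∀ k, (∀ ε, γ ε k = g k) → x k = 0 := by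
    intro k hc
    simp only [hx, hc, deriv_const]
  rw [sum_shift hk (fun k => lieDeriv₁ L (g k) (g (k + 1)) (x k))
    (fun k => lieDeriv₂ L (g (k - 1)) (g k) (x k))
    (by simp only [hxc k₀ fun ε => (hfix ε).1, map_zero])
    (by simp only [hxc k₁ fun ε => (hfix ε).2, map_zero])] at h1
  convert h1 using 1
  refine Finset.sum_congr rfl fun k _ => ?_
  rw [add_apply, add_comm]

/-- The discrete Euler-Lagrange equations. -/
theorem isExtremal_iff
    (hL : ContMDiff (𝓘(ℝ, E).prod 𝓘(ℝ, E)) 𝓘(ℝ, ℝ) ∞ (fun q : G × G => L q.1 q.2))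
    (k₀ k₁ : ℤ) (g : ℤ → G) : IsExtremal (E := E) L k₀ k₁ g ↔ ∀ k, k₀ < k → k < k₁ →
      (lieDeriv₂ L (g (k - 1)) (g k) + lieDeriv₁ L (g k) (g (k + 1)) : E →L[ℝ] ℝ) = 0 := by
  constructor
  · intro h k hk0 hk1
    ext η
    -- Only `g k` is varied, along a line in the chart with velocity `η`. The line may leave the
    -- chart, but only its germ at `0` matters.
    set γ : ℝ → ℤ → G :=
      fun ε => Function.update g k (rightParam (g k) (origin E G + ε • η)) with hγ
    have h0 : γ 0 = g := by
      simp only [hγ, zero_smul, add_zero, rightParam_origin, Function.update_eq_self]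
    have hs : ∀ j, ContMDiffAt 𝓘(ℝ, ℝ) 𝓘(ℝ, E) ∞ (fun ε => γ ε j) 0 := by
      intro j
      by_cases hj : j = k
      · subst hj
        simp only [hγ, Function.update_self]
        refine ContMDiffAt.comp (0 : ℝ) (I' := 𝓘(ℝ, E)) (g := (rightParam (g j) : E → G)) ?_ ?_
        · rw [zero_smul, add_zero]; exact contMDiffAt_rightParam _
        · exact (contDiff_const.add (contDiff_id.smul contDiff_const)).contMDiff.contMDiffAt
      · simp only [hγ, Function.update_of_ne hj]
        exact contMDiffAt_const
    have hfix : ∀ ε, γ ε k₀ = g k₀ ∧ γ ε k₁ = g k₁ := fun ε =>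
      ⟨Function.update_of_ne hk0.ne _ _, Function.update_of_ne hk1.ne' _ _⟩
    have h1 := (hasDerivAt_discreteAction hL h0 hs hfix).unique (h γ h0 hs hfix)
    rw [Finset.sum_eq_single k] at h1
    · have h2 : deriv (fun ε => (rightChart (g k) (γ ε k) : E)) 0 = η := by
        have h3 : HasDerivAt (fun ε : ℝ => origin E G + ε • η) η 0 := by
          simpa using ((hasDerivAt_id (0 : ℝ)).smul_const η).const_add (origin E G)
        refine (h3.congr_of_eventuallyEq ?_).deriv
        have h4 := h3.continuousAt.tendsto
        rw [zero_smul, add_zero] at h4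
        filter_upwards [h4.eventually (rightChart_rightParam (g k))] with ε hε
        simp only [hγ, Function.update_self, hε]
      rw [h2] at h1
      exact h1
    · intro j _ hj
      simp only [hγ, Function.update_of_ne hj, deriv_const, map_zero]
    · intro hmem
      exact absurd (Finset.mem_Ioo.2 ⟨hk0, hk1⟩) hmem
  · intro h γ h0 hs hfix
    have h1 := hasDerivAt_discreteAction hL h0 hs hfix
    rwa [Finset.sum_eq_zero fun k hk => by
      rw [h k (Finset.mem_Ioo.1 hk).1 (Finset.mem_Ioo.1 hk).2, zero_apply]] at h1

variable [FiniteDimensional ℝ E] {ζ : Lie E G} {Λ : adOrbit ζ × G → ℝ}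

theorem isExtremal_iff_solvesReduced
    (hL : ContMDiff (𝓘(ℝ, E).prod 𝓘(ℝ, E)) 𝓘(ℝ, ℝ) ∞ (fun q : G × G => L q.1 q.2))
    (hΛ : ∀ g w : G, Λ (toOrbit ζ g, w) = L g (w * g)) (k₀ k₁ : ℤ) (g : ℤ → G) :
    IsExtremal (E := E) L k₀ k₁ g ↔
      SolvesReduced Λ k₀ k₁ (fun k => toOrbit ζ (g k)) (fun k => g (k + 1) * (g k)⁻¹) := by
  have hm : ∀ k, momentum Λ (fun k => toOrbit ζ (g k)) (fun k => g (k + 1) * (g k)⁻¹) k =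
      lieDeriv₂ L (g (k - 1)) (g k) := by
    intro k
    have h := congrArg Prod.snd
      (legendre_toOrbit hΛ (g (k - 1)) (g (k - 1 + 1) * (g (k - 1))⁻¹))
    simp only [sub_add_cancel, inv_mul_cancel_right] at h
    simpa only [momentum, legendre, sub_add_cancel] using h
  have key : ∀ k, MomentumEquation Λ (toOrbit ζ (g k)) (g (k + 1) * (g k)⁻¹)
      (lieDeriv₂ L (g (k - 1)) (g k)) (lieDeriv₂ L (g k) (g (k + 1))) ↔
      (lieDeriv₂ L (g (k - 1)) (g k) + lieDeriv₁ L (g k) (g (k + 1)) : E →L[ℝ] ℝ) = 0 := by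
    intro k
    have h := momentumEquation_iff hL hΛ (g k) (g (k + 1) * (g k)⁻¹)
      (lieDeriv₂ L (g (k - 1)) (g k))
    rw [inv_mul_cancel_right] at h
    rw [h, eq_neg_iff_add_eq_zero]
  rw [isExtremal_iff hL, SolvesReduced]
  constructor
  · intro h
    refine ⟨fun k hk0 hk1 => ?_, fun k _ _ => ?_⟩
    · rw [hm, hm, add_sub_cancel_right]
      exact (key k).2 (h k hk0 hk1)
    · rw [adAct_toOrbit, inv_mul_cancel_right]
  · rintro ⟨h, -⟩ k hk0 hk1
    have h1 := h k hk0 hk1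
    rw [hm, hm, add_sub_cancel_right] at h1
    exact (key k).1 h1

/-- A group sequence with prescribed increments `w k` for `k ≥ k₀`. -/
theorem exists_sequence {G : Type*} [Group G] (k₀ : ℤ) (g₀ : G) (w : ℤ → G) :
    ∃ g : ℤ → G, g k₀ = g₀ ∧ ∀ k, k₀ ≤ k → g (k + 1) = w k * g k := by
  -- Below `k₀` the truncation `toNat` makes the sequence constantly `g₀`; those values do not enter
  -- the action.
  let s : ℕ → G := fun n => Nat.rec g₀ (fun i x => w (k₀ + i) * x) n
  refine ⟨fun k => s (k - k₀).toNat, by simp [s], fun k hk => ?_⟩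
  have h1 : (k + 1 - k₀).toNat = (k - k₀).toNat + 1 := by omega
  have h2 : k₀ + ((k - k₀).toNat : ℤ) = k := by omega
  change s (k + 1 - k₀).toNat = w k * s (k - k₀).toNat
  rw [h1]
  change w (k₀ + ((k - k₀).toNat : ℤ)) * s (k - k₀).toNat = _
  rw [h2]

/-- Lift `a k₀` and multiply up the increments. The rebuilt orbit points agree with `a` only up to
`k₁`, which suffices because `momentum` at `k` looks at index `k - 1`. -/
theorem exists_extremal_of_solvesReduced
    (hL : ContMDiff (𝓘(ℝ, E).prod 𝓘(ℝ, E)) 𝓘(ℝ, ℝ) ∞ (fun q : G × G => L q.1 q.2))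
    (hΛ : ∀ g w : G, Λ (toOrbit ζ g, w) = L g (w * g)) (k₀ k₁ : ℤ) (a : ℤ → adOrbit ζ)
    (w : ℤ → G) (h : SolvesReduced Λ k₀ k₁ a w) :
    ∃ g : ℤ → G, IsExtremal (E := E) L k₀ k₁ g ∧
      (∀ k, k₀ ≤ k → k ≤ k₁ → a k = toOrbit ζ (g k)) ∧
      ∀ k, k₀ ≤ k → k < k₁ → g (k + 1) = w k * g k := by
  obtain ⟨g₀, hg₀⟩ := exists_toOrbit_eq (a k₀)
  obtain ⟨g, hgk, hg⟩ := exists_sequence k₀ g₀ w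
  have ha : ∀ k, k₀ ≤ k → k ≤ k₁ → a k = toOrbit ζ (g k) := by
    intro k hk
    induction k, hk using Int.leInduction with
    | base => intro _; rw [hgk, hg₀]
    | succ k hk ih =>
      intro hk1
      rw [h.2 k hk (by omega), ih (by omega), hg k hk, adAct_toOrbit]
  refine ⟨g, ?_, ha, fun k hk _ => hg k hk⟩
  rw [isExtremal_iff_solvesReduced hL hΛ]
  have hw : ∀ k, k₀ ≤ k → g (k + 1) * (g k)⁻¹ = w k := by
    intro k hk; rw [hg k hk, mul_inv_cancel_right]
  have hm : ∀ k, k₀ < k → k ≤ k₁ →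
      momentum Λ (fun k => toOrbit ζ (g k)) (fun k => g (k + 1) * (g k)⁻¹) k =
        momentum Λ a w k := by
    intro k hk hk1
    simp only [momentum, hw (k - 1) (by omega), ha (k - 1) (by omega) (by omega)]
  refine ⟨fun k hk0 hk1 => ?_, fun k _ _ => ?_⟩
  · have h1 := h.1 k hk0 hk1
    rw [hm k hk0 hk1.le, hm (k + 1) (by omega) (by omega)]
    change MomentumEquation Λ (toOrbit ζ (g k)) (g (k + 1) * (g k)⁻¹) _ _
    rwa [hw k hk0.le, ← ha k hk0.le hk1.le]
  · rw [adAct_toOrbit, inv_mul_cancel_right]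

end Extremal

theorem orbitOpen_univ {E : Type*} [NormedAddCommGroup E] [NormedSpace ℝ E]
    {G : Type*} [TopologicalSpace G] [ChartedSpace E G] [Group G] {ζ : Lie E G}
    {X : Type*} [TopologicalSpace X] :
    OrbitOpen (Set.univ : Set (adOrbit ζ × X)) := isOpen_univ

/-! ### Regularity of the lifted maps and invariance of the bracket. -/

section Regular

variable {E : Type*} [NormedAddCommGroup E] [NormedSpace ℝ E]
  {G : Type*} [TopologicalSpace G] [ChartedSpace E G] [Group G] [LieGroup 𝓘(ℝ, E) ∞ G]
  {L : G → G → ℝ} {ζ : Lie E G} {Λ : adOrbit ζ × G → ℝ}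

theorem OrbitSmoothOn.contDiffAt {F : Type*} [NormedAddCommGroup F] [NormedSpace ℝ F]
    {f : adOrbit ζ × F → ℝ} {D : Set (adOrbit ζ × F)} (hf : OrbitSmoothOn F f D)
    (hD : OrbitOpen D) {g : G} {m : F} (h : (toOrbit ζ g, m) ∈ D) :
    ContDiffAt ℝ ∞ (fun p : E × F => f (toOrbit ζ (rightParam g p.1), p.2)) (origin E G, m) :=
  contMDiffAt_prod_rightParam_comp.1 (ContMDiffOn.contMDiffAt hf (IsOpen.mem_nhds hD h))

theorem eventually_nhds_of_rightParam {F : Type*} [TopologicalSpace F] {g : G} {m : F}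
    {P : G × F → Prop} (h : ∀ᶠ q in 𝓝 (origin E G, m), P (rightParam g q.1, q.2)) :
    ∀ᶠ z in 𝓝 (g, m), P z := by
  rw [nhds_prod_eq, ← map_rightParam_nhds (E := E) g, ← map_id (f := 𝓝 m), prod_map_map_eq,
    eventually_map, ← nhds_prod_eq]
  exact h

theorem eventually_nhds_of_rightParam₂ {g g' : G}
    {P : G × G → Prop} (h : ∀ᶠ q in 𝓝 (origin E G, origin E G),
      P (rightParam g q.1, rightParam g' q.2)) :
    ∀ᶠ z in 𝓝 (g, g'), P z := by
  rw [nhds_prod_eq, ← map_rightParam_nhds (E := E) g, ← map_rightParam_nhds (E := E) g',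
    prod_map_map_eq, eventually_map, ← nhds_prod_eq]
  exact h

theorem tendsto_rightParam₂ (g g' : G) :
    Tendsto (fun p : E × E => (rightParam g p.1, rightParam g' p.2))
      (𝓝 (origin E G, origin E G)) (𝓝 (g, g')) := by
  rw [nhds_prod_eq, nhds_prod_eq]
  exact (tendsto_rightParam g).prodMap (tendsto_rightParam g')

/-- Being in an open subset of `𝔤_ζ × G` is an open condition on `(g, g')`, `w = g' g⁻¹`. -/
theorem eventually_mem_of_orbitOpen {U : Set (adOrbit ζ × G)} (hU : OrbitOpen U) {g g' : G}
    (h : (toOrbit ζ g, g' * g⁻¹) ∈ U) :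
    ∀ᶠ p : E × E in 𝓝 (origin E G, origin E G),
      (toOrbit ζ (rightParam g p.1), rightParam g' p.2 * (rightParam g p.1)⁻¹) ∈ U := by
  have : IsTopologicalGroup G := topologicalGroup_of_lieGroup 𝓘(ℝ, E) ∞
  have hc : Continuous fun q : G × G => (q.1, q.2 * q.1⁻¹) :=
    continuous_fst.prodMk (continuous_snd.mul continuous_fst.inv)
  have h1 : ∀ᶠ q in 𝓝 (g, g'), (q.1, q.2 * q.1⁻¹) ∈ orbitPreimage U :=
    hc.continuousAt.eventually (IsOpen.mem_nhds hU h)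
  exact (tendsto_rightParam₂ g g').eventually h1

variable [FiniteDimensional ℝ E]

/-- A local diffeomorphism is open: what holds along the image of `θ` holds near the image point. -/
theorem eventually_of_bijective_fderiv {θ : E × E → E × (E →L[ℝ] ℝ)}
    (hθ : ContDiffAt ℝ ∞ θ (origin E G, origin E G))
    (hb : Function.Bijective (fderiv ℝ θ (origin E G, origin E G)))
    (h0 : (θ (origin E G, origin E G)).1 = origin E G) {g : G} {P : G × (E →L[ℝ] ℝ) → Prop}
    (h : ∀ᶠ p in 𝓝 (origin E G, origin E G), P (rightParam g (θ p).1, (θ p).2)) :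
    ∀ᶠ z in 𝓝 (g, (θ (origin E G, origin E G)).2), P z := by
  obtain ⟨σ, hσ, hσ0, hr, -⟩ := exists_smooth_localInverse hθ hb
  refine eventually_nhds_of_rightParam (E := E) ?_
  have h1 := hσ.continuousAt.tendsto
  rw [hσ0] at h1
  have h2 : θ (origin E G, origin E G) = (origin E G, (θ (origin E G, origin E G)).2) :=
    Prod.ext h0 rfl
  rw [← h2]
  filter_upwards [hr, h1.eventually h] with q hq1 hq2
  rwa [hq1] at hq2

/-- A globally smooth function on `G` that agrees with a coordinate function near `1`. -/
theorem exists_contMDiff_eq_coordinate [T2Space G] (ℓ : E →L[ℝ] ℝ) :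
    ∃ χ : G → ℝ, ContMDiff 𝓘(ℝ, E) 𝓘(ℝ, ℝ) ∞ χ ∧
      ∀ᶠ h in 𝓝 1, χ h = ℓ (extChartAt 𝓘(ℝ, E) (1 : G) h) := by
  obtain ⟨b⟩ : Nonempty (SmoothBumpFunction 𝓘(ℝ, E) (1 : G)) :=
    inferInstance
  have h1 : ContMDiffOn 𝓘(ℝ, E) 𝓘(ℝ, ℝ) ∞ (fun h => ℓ (extChartAt 𝓘(ℝ, E) (1 : G) h))
      (chartAt E (1 : G)).source :=
    ℓ.contMDiff.comp_contMDiffOn contMDiffOn_extChartAt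
  refine ⟨fun h => b h • ℓ (extChartAt 𝓘(ℝ, E) (1 : G) h), b.contMDiff_smul h1, ?_⟩
  filter_upwards [b.eventuallyEq_one] with h hh
  rw [hh]; simp

/-- A kernel vector has no `g'` component, because the Legendre map retains `g'`. With `g'` fixed,
`g = w⁻¹ g'` is recovered from the `w` component of the smooth inverse `κ`, so no `g` component
survives either. -/
theorem injective_fderiv_legendreChart [T2Space G]
    (hL : ContMDiff (𝓘(ℝ, E).prod 𝓘(ℝ, E)) 𝓘(ℝ, ℝ) ∞ (fun q : G × G => L q.1 q.2))
    (hΛ : ∀ g w : G, Λ (toOrbit ζ g, w) = L g (w * g)) {U : Set (adOrbit ζ × G)}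
    (hU : LegendreInvertibleOn Λ U) {g g' : G} (h : (toOrbit ζ g, g' * g⁻¹) ∈ U) :
    Function.Injective
      (fderiv ℝ (legendreChart G (lagrangianChart L g g')) (origin E G, origin E G)) := by
  obtain ⟨hUo, hIo, κ, hκ, hκ'⟩ := hU
  have hA := (contDiffAt_legendreChart (contDiffAt_lagrangianChart hL g g')).differentiableAt
    (by simp) |>.hasFDerivAt
  set A := legendreChart G (lagrangianChart (E := E) L g g') with hAdef
  refine (injective_iff_map_eq_zero _).2 fun u hu => ?_
  have hu2 : u.2 = 0 := by
    have h1 := fderiv_legendreChart (contDiffAt_lagrangianChart hL g g') u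
    rw [hu] at h1
    exact (congrArg Prod.fst h1).symm
  have hu1 : u.1 = 0 := by
    by_contra hne
    obtain ⟨ℓ, hℓ⟩ := SeparatingDual.exists_ne_zero (R := ℝ) hne
    obtain ⟨χ, hχ, hχ1⟩ := exists_contMDiff_eq_coordinate (E := E) (G := G) ℓ
    -- Smoothness of `κ` is known only through globally smooth functions. This one ignores the orbit
    -- variable, and at `w = g' (h g)⁻¹` its value is `χ h`, which is `ℓ` of the coordinate of `h`
    -- near `1`.
    have hf : OrbitSmoothOn E (fun x : adOrbit ζ × G => χ (x.2⁻¹ * (g' * g⁻¹))) Set.univ := by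
      refine ContMDiff.contMDiffOn (hχ.comp ?_)
      exact (contMDiff_snd.inv).mul contMDiff_const
    have hH := hκ _ hf
    have hmem : (toOrbit ζ g', (A (origin E G, origin E G)).2) ∈ legendre Λ '' U := by
      rw [legendre_mem_image_iff hΛ]
      exact ⟨g, h, (lieDeriv₂_eq hL g g').symm⟩
    have hHd := (OrbitSmoothOn.contDiffAt hH hIo hmem).differentiableAt (by simp) |>.hasFDerivAt
    have hc := HasFDerivAt.comp (origin E G, origin E G) (f := A) (g := fun p : E × (E →L[ℝ] ℝ) =>
      χ ((κ (toOrbit ζ (rightParam g' p.1), p.2)).2⁻¹ * (g' * g⁻¹))) hHd hA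
    have hc2 := HasFDerivAt.comp (origin E G) (f := fun x : E => (x, origin E G)) hc
      (hasFDerivAt_prodMk_left (origin E G) (origin E G))
    have ht : Tendsto (fun x : E => (x, origin E G)) (𝓝 (origin E G))
        (𝓝 (origin E G, origin E G)) :=
      (continuous_id.prodMk continuous_const).tendsto _
    have he : ℓ =ᶠ[𝓝 (origin E G)] ((fun p : E × (E →L[ℝ] ℝ) =>
        χ ((κ (toOrbit ζ (rightParam g' p.1), p.2)).2⁻¹ * (g' * g⁻¹))) ∘ A) ∘
        fun x : E => (x, origin E G) := by
      have hs := (contMDiffAt_symm_origin (E := E) (G := G)).continuousAt.tendsto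
      rw [symm_origin] at hs
      filter_upwards [ht.eventually (eventually_mem_of_orbitOpen hUo h),
        ht.eventually (lieDeriv₂_rightParam hL g g'), hs.eventually hχ1,
        target_mem_nhds_origin (E := E) (G := G)] with x h1 h2 h3 h4
      simp only [rightParam_origin] at h1 h2
      have h5 := hκ' _ h1
      rw [legendre_toOrbit hΛ, inv_mul_cancel_right, h2] at h5
      change ℓ x = χ ((κ (toOrbit ζ (rightParam g' (origin E G)), (A (x, origin E G)).2)).2⁻¹ *
        (g' * g⁻¹))
      rw [rightParam_origin, h5]
      have h6 : (g' * (rightParam g x)⁻¹)⁻¹ * (g' * g⁻¹) =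
          (extChartAt 𝓘(ℝ, E) (1 : G)).symm x := by
        simp [rightParam, mul_assoc]
      rw [h6, h3, (extChartAt 𝓘(ℝ, E) (1 : G)).right_inv h4]
    have h7 := congrArg (fun T : E →L[ℝ] ℝ => T u.1)
      (ℓ.hasFDerivAt.unique (hc2.congr_of_eventuallyEq he))
    have h8 : ((u.1, 0) : E × E) = u := Prod.ext rfl hu2.symm
    simp only [ContinuousLinearMap.comp_apply, ContinuousLinearMap.inl_apply, h8, hu,
      map_zero] at h7
    exact hℓ h7
  exact Prod.ext hu1 hu2

theorem bijective_fderiv_charts [T2Space G]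
    (hL : ContMDiff (𝓘(ℝ, E).prod 𝓘(ℝ, E)) 𝓘(ℝ, ℝ) ∞ (fun q : G × G => L q.1 q.2))
    (hΛ : ∀ g w : G, Λ (toOrbit ζ g, w) = L g (w * g)) {U : Set (adOrbit ζ × G)}
    (hU : LegendreInvertibleOn Λ U) {g g' : G} (h : (toOrbit ζ g, g' * g⁻¹) ∈ U) :
    Function.Bijective
      (fderiv ℝ (legendreChart G (lagrangianChart L g g')) (origin E G, origin E G)) ∧
    Function.Bijective
      (fderiv ℝ (momentumChart G (lagrangianChart L g g')) (origin E G, origin E G)) := by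
  have hi := injective_fderiv_legendreChart hL hΛ hU h
  have hs := surjective_of_injective _ hi
  have hs' := surjective_of_symplForm_eq
    (symplForm_legendreChart_eq (contDiffAt_lagrangianChart hL g g')) hs
  exact ⟨⟨hi, hs⟩, injective_of_surjective _ hs', hs'⟩

/-- Near a step, the charts of the generating function parametrize steps. -/
theorem eventually_step
    (hL : ContMDiff (𝓘(ℝ, E).prod 𝓘(ℝ, E)) 𝓘(ℝ, ℝ) ∞ (fun q : G × G => L q.1 q.2))
    (hΛ : ∀ g w : G, Λ (toOrbit ζ g, w) = L g (w * g)) {U : Set (adOrbit ζ × G)}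
    (hU : OrbitOpen U) {g g' : G} (h : (toOrbit ζ g, g' * g⁻¹) ∈ U) :
    ∀ᶠ p in 𝓝 (origin E G, origin E G), Step Λ U
      (toOrbit ζ (rightParam g (momentumChart G (lagrangianChart L g g') p).1),
        (momentumChart G (lagrangianChart L g g') p).2)
      (toOrbit ζ (rightParam g' (legendreChart G (lagrangianChart L g g') p).1),
        (legendreChart G (lagrangianChart L g g') p).2) := by
  filter_upwards [eventually_mem_of_orbitOpen hU h, lieDeriv₂_rightParam hL g g',
    lieDeriv₁_rightParam hL g g'] with p h1 h2 h3
  rw [step_toOrbit_iff hL hΛ]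
  exact ⟨rightParam g' p.2, h1, h3.symm, by rw [← h2]; rfl⟩

/-- Only `h q' = f q` along steps is required, so the statement treats both ends alike: with `h = f
∘ Ψ` it serves the backward map, with `f = h ∘ Φ` the forward one. -/
theorem poissonBracket_eq_of_step [T2Space G]
    (hL : ContMDiff (𝓘(ℝ, E).prod 𝓘(ℝ, E)) 𝓘(ℝ, ℝ) ∞ (fun q : G × G => L q.1 q.2))
    (hΛ : ∀ g w : G, Λ (toOrbit ζ g, w) = L g (w * g)) {U : Set (adOrbit ζ × G)}
    (hU : LegendreInvertibleOn Λ U) {p p' : adOrbit ζ × LieDual E} (hp : Step Λ U p p')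
    {f₁ f₂ h₁ h₂ : adOrbit ζ × LieDual E → ℝ} {D D' : Set (adOrbit ζ × LieDual E)}
    (hD : OrbitOpen D) (hD' : OrbitOpen D') (hpD : p ∈ D) (hpD' : p' ∈ D')
    (hf₁ : OrbitSmoothOn (LieDual E) f₁ D) (hf₂ : OrbitSmoothOn (LieDual E) f₂ D)
    (hh₁ : OrbitSmoothOn (LieDual E) h₁ D') (hh₂ : OrbitSmoothOn (LieDual E) h₂ D')
    (he₁ : ∀ q q', Step Λ U q q' → h₁ q' = f₁ q) (he₂ : ∀ q q', Step Λ U q q' → h₂ q' = f₂ q) :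
    poissonBracket h₁ h₂ p' = poissonBracket f₁ f₂ p := by
  obtain ⟨a, m⟩ := p
  obtain ⟨g, rfl⟩ := exists_toOrbit_eq a
  obtain ⟨g', hgU, hm, rfl⟩ := (step_toOrbit_iff hL hΛ U g m p').1 hp
  have hF := contDiffAt_lagrangianChart hL g g'
  set F := lagrangianChart (E := E) L g g' with hFdef
  rw [neg_lieDeriv₁_eq hL] at hm
  subst hm
  rw [lieDeriv₂_eq hL] at hpD' ⊢
  have d : ∀ (k : G) (f : adOrbit ζ × LieDual E → ℝ) (D : Set (adOrbit ζ × LieDual E))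
      (m : LieDual E), OrbitOpen D → OrbitSmoothOn (LieDual E) f D → (toOrbit ζ k, m) ∈ D →
      DifferentiableAt ℝ (fun p : E × (E →L[ℝ] ℝ) => f (toOrbit ζ (rightParam k p.1), p.2))
        (origin E G, m) := fun k f D m hD hf hk =>
    (OrbitSmoothOn.contDiffAt hf hD hk).differentiableAt (by simp)
  have d1 := d g f₁ D _ hD hf₁ hpD
  have d2 := d g f₂ D _ hD hf₂ hpD
  have d3 := d g' h₁ D' _ hD' hh₁ hpD'
  have d4 := d g' h₂ D' _ hD' hh₂ hpD'
  obtain ⟨v, hv, hPf⟩ := exists_poissonBracket_eq f₁ f₂ g _ d1 d2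
  obtain ⟨v', hv', hPh⟩ := exists_poissonBracket_eq h₁ h₂ g' _ d3 d4
  obtain ⟨⟨-, hA⟩, ⟨-, hB⟩⟩ := bijective_fderiv_charts hL hΛ hU hgU
  have hAd := ((contDiffAt_legendreChart hF).differentiableAt (by simp)).hasFDerivAt
  have hBd := ((contDiffAt_momentumChart hF).differentiableAt (by simp)).hasFDerivAt
  have hst := eventually_step hL hΛ hU.1 hgU
  -- The differentials of `h` and `f` become the same covector on `(g, g')`-space, since the two
  -- charts parametrize pairs of points related by a step.
  have hchain : ∀ (f h : adOrbit ζ × LieDual E → ℝ),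
      DifferentiableAt ℝ (fun p : E × (E →L[ℝ] ℝ) => f (toOrbit ζ (rightParam g p.1), p.2))
        (origin E G, (momentumChart G F (origin E G, origin E G)).2) →
      DifferentiableAt ℝ (fun p : E × (E →L[ℝ] ℝ) => h (toOrbit ζ (rightParam g' p.1), p.2))
        (origin E G, (legendreChart G F (origin E G, origin E G)).2) →
      (∀ q q', Step Λ U q q' → h q' = f q) →
      (fderiv ℝ (fun p : E × (E →L[ℝ] ℝ) => h (toOrbit ζ (rightParam g' p.1), p.2))
        (origin E G, (legendreChart G F (origin E G, origin E G)).2)).comp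
          (fderiv ℝ (legendreChart G F) (origin E G, origin E G)) =
      (fderiv ℝ (fun p : E × (E →L[ℝ] ℝ) => f (toOrbit ζ (rightParam g p.1), p.2))
        (origin E G, (momentumChart G F (origin E G, origin E G)).2)).comp
          (fderiv ℝ (momentumChart G F) (origin E G, origin E G)) := by
    intro f h hf hh he
    have c1 := HasFDerivAt.comp (origin E G, origin E G) (f := momentumChart G F)
      (g := fun p : E × (E →L[ℝ] ℝ) => f (toOrbit ζ (rightParam g p.1), p.2)) hf.hasFDerivAt hBd
    have c2 := HasFDerivAt.comp (origin E G, origin E G) (f := legendreChart G F)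
      (g := fun p : E × (E →L[ℝ] ℝ) => h (toOrbit ζ (rightParam g' p.1), p.2)) hh.hasFDerivAt hAd
    refine c2.unique (c1.congr_of_eventuallyEq ?_)
    filter_upwards [hst] with p hp
    exact he _ _ hp
  rw [hPf, hPh, apply_hamiltonian_eq (symplForm_legendreChart_eq hF) hA hB
    (hchain f₁ h₁ d1 d3 he₁) (hchain f₂ h₂ d2 d4 he₂) hv hv']

end Regular

/-! ### The backward map, local single-valuedness and the forward map. -/

section StepMaps

variable {E : Type*} [NormedAddCommGroup E] [NormedSpace ℝ E] [FiniteDimensional ℝ E]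
  {G : Type*} [TopologicalSpace G] [ChartedSpace E G] [Group G] [LieGroup 𝓘(ℝ, E) ∞ G]
  {L : G → G → ℝ} {ζ : Lie E G} {Λ : adOrbit ζ × G → ℝ}

/-- The initial phase point `(a, m)` of the step that starts at `(a, w)`. -/
def initialPhase (Λ : adOrbit ζ × G → ℝ) (x : adOrbit ζ × G) : adOrbit ζ × LieDual E :=
  (x.1, coAd x.2 (legendre Λ x).2 + coad x.1 (orbitGradient (fun b => Λ (b, x.2)) x.1))

theorem initialPhase_toOrbit
    (hL : ContMDiff (𝓘(ℝ, E).prod 𝓘(ℝ, E)) 𝓘(ℝ, ℝ) ∞ (fun q : G × G => L q.1 q.2))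
    (hΛ : ∀ g w : G, Λ (toOrbit ζ g, w) = L g (w * g)) (g w : G) :
    initialPhase Λ (toOrbit ζ g, w) = (toOrbit ζ g, -lieDeriv₁ L g (w * g)) := by
  rw [initialPhase, legendre_toOrbit hΛ]
  exact Prod.ext rfl (sub_coad_orbitGradient_reduced hL hΛ g w)

/-- The momentum equation is explicit in `m`, so the backward step is determined as soon as `κ`
returns `(a, w)`. -/
theorem step_iff_of_leftInverse {U : Set (adOrbit ζ × G)}
    {κ : adOrbit ζ × LieDual E → adOrbit ζ × G} (hκ : ∀ x ∈ U, κ (legendre Λ x) = x)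
    (p p' : adOrbit ζ × LieDual E) :
    Step Λ U p p' ↔ p' ∈ legendre Λ '' U ∧ p = initialPhase Λ (κ p') := by
  constructor
  · rintro ⟨w, hw, rfl, hm⟩
    refine ⟨⟨_, hw, rfl⟩, ?_⟩
    rw [hκ _ hw]
    refine Prod.ext rfl ?_
    exact (eq_add_of_sub_eq hm.symm)
  · rintro ⟨⟨x, hx, rfl⟩, hp⟩
    rw [hκ x hx] at hp
    subst hp
    exact ⟨x.2, hx, rfl, (add_sub_cancel_right _ _).symm⟩

theorem orbitSmoothOn_comp_initialPhase
    (hL : ContMDiff (𝓘(ℝ, E).prod 𝓘(ℝ, E)) 𝓘(ℝ, ℝ) ∞ (fun q : G × G => L q.1 q.2))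
    (hΛ : ∀ g w : G, Λ (toOrbit ζ g, w) = L g (w * g)) {f : adOrbit ζ × LieDual E → ℝ}
    (hf : OrbitSmoothOn (LieDual E) f Set.univ) :
    OrbitSmoothOn E (fun x => f (initialPhase Λ x)) Set.univ := by
  refine ContMDiff.contMDiffOn ?_
  have hf' : ContMDiff (𝓘(ℝ, E).prod 𝓘(ℝ, E →L[ℝ] ℝ)) 𝓘(ℝ, ℝ) ∞
      (fun q : G × (E →L[ℝ] ℝ) => f (toOrbit ζ q.1, q.2)) := contMDiffOn_univ.1 hf
  have h1 : ContMDiff (𝓘(ℝ, E).prod 𝓘(ℝ, E)) (𝓘(ℝ, E).prod 𝓘(ℝ, E)) ∞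
      (fun q : G × G => (q.1, q.2 * q.1)) := contMDiff_fst.prodMk (contMDiff_snd.mul contMDiff_fst)
  have h2 := hf'.comp (contMDiff_fst.prodMk ((contMDiff_neg_lieDeriv₁ hL).comp h1))
  refine h2.congr fun q => ?_
  exact congrArg f (initialPhase_toOrbit hL hΛ q.1 q.2)

theorem exists_backward_map [T2Space G]
    (hL : ContMDiff (𝓘(ℝ, E).prod 𝓘(ℝ, E)) 𝓘(ℝ, ℝ) ∞ (fun q : G × G => L q.1 q.2))
    (hΛ : ∀ g w : G, Λ (toOrbit ζ g, w) = L g (w * g)) {U : Set (adOrbit ζ × G)}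
    (hU : LegendreInvertibleOn Λ U) :
    ∃ Ψ : adOrbit ζ × LieDual E → adOrbit ζ × LieDual E,
      (∀ p p', Step Λ U p p' ↔ p' ∈ legendre Λ '' U ∧ p = Ψ p') ∧
      IsPoissonMapOn Ψ (legendre Λ '' U) := by
  obtain ⟨hUo, hIo, κ, hκ, hκ'⟩ := id hU
  have hstep := step_iff_of_leftInverse (Λ := Λ) hκ'
  have hsm : ∀ f : adOrbit ζ × LieDual E → ℝ, OrbitSmoothOn (LieDual E) f Set.univ →
      OrbitSmoothOn (LieDual E) (fun p => f (initialPhase Λ (κ p))) (legendre Λ '' U) :=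
    fun f hf => hκ _ (orbitSmoothOn_comp_initialPhase hL hΛ hf)
  refine ⟨fun p' => initialPhase Λ (κ p'), hstep, hsm, ?_⟩
  intro f₁ f₂ hf₁ hf₂ p' hp'
  have hs : Step Λ U (initialPhase Λ (κ p')) p' := (hstep _ _).2 ⟨hp', rfl⟩
  exact poissonBracket_eq_of_step hL hΛ hU hs orbitOpen_univ hIo trivial hp' hf₁ hf₂
    (hsm f₁ hf₁) (hsm f₂ hf₂)
    (fun q q' hq => by rw [((hstep q q').1 hq).2]) (fun q q' hq => by rw [((hstep q q').1 hq).2])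

theorem orbitOpen_legendre_image [T2Space G]
    (hL : ContMDiff (𝓘(ℝ, E).prod 𝓘(ℝ, E)) 𝓘(ℝ, ℝ) ∞ (fun q : G × G => L q.1 q.2))
    (hΛ : ∀ g w : G, Λ (toOrbit ζ g, w) = L g (w * g)) {U V : Set (adOrbit ζ × G)}
    (hU : LegendreInvertibleOn Λ U) (hVU : V ⊆ U) (hV : OrbitOpen V) :
    OrbitOpen (legendre Λ '' V) := by
  refine isOpen_iff_mem_nhds.2 ?_
  rintro ⟨g', m'⟩ hm
  obtain ⟨g, hg, rfl⟩ := (legendre_mem_image_iff hΛ V g' m').1 hm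
  rw [lieDeriv₂_eq hL]
  refine eventually_of_bijective_fderiv
    (contDiffAt_legendreChart (contDiffAt_lagrangianChart hL g g'))
    (bijective_fderiv_charts hL hΛ hU (hVU hg)).1 rfl
    (P := fun z => (toOrbit ζ z.1, z.2) ∈ legendre Λ '' V) ?_
  filter_upwards [eventually_step hL hΛ hV hg] with p hp
  obtain ⟨w, hw, hp', -⟩ := hp
  exact ⟨_, hw, hp'.symm⟩

theorem LegendreInvertibleOn.mono [T2Space G]
    (hL : ContMDiff (𝓘(ℝ, E).prod 𝓘(ℝ, E)) 𝓘(ℝ, ℝ) ∞ (fun q : G × G => L q.1 q.2))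
    (hΛ : ∀ g w : G, Λ (toOrbit ζ g, w) = L g (w * g)) {U V : Set (adOrbit ζ × G)}
    (hU : LegendreInvertibleOn Λ U) (hVU : V ⊆ U) (hV : OrbitOpen V) :
    LegendreInvertibleOn Λ V := by
  refine ⟨hV, orbitOpen_legendre_image hL hΛ hU hVU hV, ?_⟩
  obtain ⟨-, -, κ, hκ, hκ'⟩ := hU
  refine ⟨κ, fun f hf => ContMDiffOn.mono (hκ f hf) ?_, fun x hx => hκ' x (hVU hx)⟩
  exact fun q hq => Set.image_mono hVU hq

/-- The saturation of an open subset of `G` is open. -/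
theorem isOpen_saturation {N : Set G} (hN : IsOpen N) :
    IsOpen {k : G | ∃ k₁ ∈ N, toOrbit ζ k₁ = toOrbit ζ k} := by
  have : ContinuousMul G := continuousMul_of_contMDiffMul 𝓘(ℝ, E) ∞
  refine isOpen_iff_mem_nhds.2 ?_
  rintro k ⟨k₁, hk₁, hk⟩
  -- The factor `k⁻¹ k₁` fixes `ζ`, so right multiplication by it preserves the fibres over the
  -- orbit.
  have hc : Continuous fun x : G => x * (k⁻¹ * k₁) := continuous_id.mul continuous_const
  have hN' : N ∈ 𝓝 (k * (k⁻¹ * k₁)) := by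
    rw [mul_inv_cancel_left]; exact hN.mem_nhds hk₁
  filter_upwards [hc.continuousAt.preimage_mem_nhds hN'] with x hx
  refine ⟨x * (k⁻¹ * k₁), hx, ?_⟩
  rw [← mul_assoc, ← adAct_toOrbit, hk, adAct_toOrbit, inv_mul_cancel_right]

/-- The map `B` is locally injective by the inverse function theorem: near the given step, `g` and
`m = -d₁L(g, g')` determine `g'`. -/
theorem exists_singleValued_subset [T2Space G]
    (hL : ContMDiff (𝓘(ℝ, E).prod 𝓘(ℝ, E)) 𝓘(ℝ, ℝ) ∞ (fun q : G × G => L q.1 q.2))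
    (hΛ : ∀ g w : G, Λ (toOrbit ζ g, w) = L g (w * g)) {U : Set (adOrbit ζ × G)}
    (hU : LegendreInvertibleOn Λ U) {p p' : adOrbit ζ × LieDual E} (hp : Step Λ U p p') :
    ∃ V ⊆ U, LegendreInvertibleOn Λ V ∧ Step Λ V p p' ∧
      ∀ q q' q'', Step Λ V q q' → Step Λ V q q'' → q' = q'' := by
  obtain ⟨a, m⟩ := p
  obtain ⟨g, rfl⟩ := exists_toOrbit_eq a
  obtain ⟨g', hgU, hm, hp'⟩ := (step_toOrbit_iff hL hΛ U g m p').1 hp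
  have hF := contDiffAt_lagrangianChart hL g g'
  obtain ⟨σ, -, -, -, hσ⟩ := exists_smooth_localInverse (contDiffAt_momentumChart hF)
    (bijective_fderiv_charts hL hΛ hU hgU).2
  have h1 : ∀ᶠ z : G × G in 𝓝 (g, g'), σ (rightChart g z.1, -lieDeriv₁ L z.1 z.2) =
      (rightChart g z.1, rightChart g' z.2) ∧ rightParam g' (rightChart g' z.2 : E) = z.2 := by
    refine eventually_nhds_of_rightParam₂ (E := E) ?_
    have h2 := continuousAt_fst.tendsto (x := (origin E G, origin E G)) |>.eventually
      (rightChart_rightParam (E := E) g)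
    have h3 := continuousAt_snd.tendsto (x := (origin E G, origin E G)) |>.eventually
      (rightChart_rightParam (E := E) g')
    filter_upwards [hσ, h2, h3, lieDeriv₁_rightParam hL g g'] with p e1 e2 e3 e4
    rw [e2, e3, e4]
    exact ⟨e1, rfl⟩
  have : ContinuousMul G := continuousMul_of_contMDiffMul 𝓘(ℝ, E) ∞
  have hc : Tendsto (fun z : G × G => (z.1, z.2 * z.1)) (𝓝 (g, g' * g⁻¹)) (𝓝 (g, g')) := by
    have h : Continuous fun z : G × G => (z.1, z.2 * z.1) :=
      continuous_fst.prodMk (continuous_snd.mul continuous_fst)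
    have h2 := h.tendsto (g, g' * g⁻¹)
    rwa [inv_mul_cancel_right] at h2
  obtain ⟨N₁, hN₁, hg₁, N₂, hN₂, hg₂, hN⟩ : ∃ N₁ : Set G, IsOpen N₁ ∧ g ∈ N₁ ∧ ∃ N₂ : Set G,
      IsOpen N₂ ∧ g' * g⁻¹ ∈ N₂ ∧ N₁ ×ˢ N₂ ⊆ {z : G × G |
        σ (rightChart g z.1, -lieDeriv₁ L z.1 (z.2 * z.1)) =
          (rightChart g z.1, rightChart g' (z.2 * z.1)) ∧
          rightParam g' (rightChart g' (z.2 * z.1) : E) = z.2 * z.1} := by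
    obtain ⟨N₁, N₂, h1, h2, h3, h4, h5⟩ := mem_nhds_prod_iff'.1 (hc.eventually h1)
    exact ⟨N₁, h1, h2, N₂, h3, h4, h5⟩
  -- Locality in `g` has to be phrased on the orbit: some representative lies in `N₁`. Two steps
  -- from one point are then lifted with the same representative.
  set V : Set (adOrbit ζ × G) := {x | x ∈ U ∧ (∃ k ∈ N₁, toOrbit ζ k = x.1) ∧ x.2 ∈ N₂} with hVdef
  have hVU : V ⊆ U := fun x hx => hx.1
  have hV : OrbitOpen V := by
    have h2 : IsOpen (orbitPreimage U) := hU.1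
    exact h2.inter (((isOpen_saturation (ζ := ζ) hN₁).preimage continuous_fst).inter
      (hN₂.preimage continuous_snd))
  refine ⟨V, hVU, hU.mono hL hΛ hVU hV, ?_, ?_⟩
  · exact (step_toOrbit_iff hL hΛ V g m p').2 ⟨g', ⟨hgU, ⟨g, hg₁, rfl⟩, hg₂⟩, hm, hp'⟩
  · rintro ⟨b, μ⟩ q' q'' hq' hq''
    obtain ⟨k, hk, hkb⟩ : ∃ k ∈ N₁, toOrbit ζ k = b := by
      obtain ⟨w, hw, -⟩ := hq'
      exact hw.2.1
    subst hkb
    obtain ⟨k', hk', hμ', rfl⟩ := (step_toOrbit_iff hL hΛ V k μ q').1 hq'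
    obtain ⟨k'', hk'', hμ'', rfl⟩ := (step_toOrbit_iff hL hΛ V k μ q'').1 hq''
    have e1 := hN (Set.mk_mem_prod hk hk'.2.2)
    have e2 := hN (Set.mk_mem_prod hk hk''.2.2)
    simp only [Set.mem_ofPred_eq, inv_mul_cancel_right] at e1 e2
    rw [← hμ'] at e1
    rw [← hμ''] at e2
    have e3 := congrArg Prod.snd (e1.1.symm.trans e2.1)
    have e4 : k' = k'' := by
      rw [← e1.2, ← e2.2]; exact congrArg (rightParam g') e3
    rw [e4]

theorem orbitOpen_step_domain [T2Space G]
    (hL : ContMDiff (𝓘(ℝ, E).prod 𝓘(ℝ, E)) 𝓘(ℝ, ℝ) ∞ (fun q : G × G => L q.1 q.2))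
    (hΛ : ∀ g w : G, Λ (toOrbit ζ g, w) = L g (w * g)) {U : Set (adOrbit ζ × G)}
    (hU : LegendreInvertibleOn Λ U) : OrbitOpen {p | ∃ p', Step Λ U p p'} := by
  refine isOpen_iff_mem_nhds.2 ?_
  rintro ⟨g, m⟩ ⟨p', hp⟩
  obtain ⟨g', hgU, rfl, hp'⟩ := (step_toOrbit_iff hL hΛ U g m p').1 hp
  rw [neg_lieDeriv₁_eq hL]
  refine eventually_of_bijective_fderiv
    (contDiffAt_momentumChart (contDiffAt_lagrangianChart hL g g'))
    (bijective_fderiv_charts hL hΛ hU hgU).2 rfl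
    (P := fun z => ∃ p', Step Λ U (toOrbit ζ z.1, z.2) p') ?_
  filter_upwards [eventually_step hL hΛ hU.1 hgU] with p hp
  exact ⟨_, hp⟩

/-- Single-valuedness identifies `Φ` near each point of its domain with the local map `A ∘ B⁻¹`,
which gives smoothness. -/
theorem exists_forward_map [T2Space G]
    (hL : ContMDiff (𝓘(ℝ, E).prod 𝓘(ℝ, E)) 𝓘(ℝ, ℝ) ∞ (fun q : G × G => L q.1 q.2))
    (hΛ : ∀ g w : G, Λ (toOrbit ζ g, w) = L g (w * g)) {U : Set (adOrbit ζ × G)}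
    (hU : LegendreInvertibleOn Λ U)
    (hs : ∀ q q' q'', Step Λ U q q' → Step Λ U q q'' → q' = q'') :
    ∃ Φ : adOrbit ζ × LieDual E → adOrbit ζ × LieDual E,
      (∀ p p', Step Λ U p p' ↔ (∃ q', Step Λ U p q') ∧ p' = Φ p) ∧
      IsPoissonMapOn Φ {p | ∃ p', Step Λ U p p'} := by
  have hex : ∀ p, ∃ p', (∃ q', Step Λ U p q') → Step Λ U p p' := by
    intro p
    by_cases h : ∃ q', Step Λ U p q'
    · obtain ⟨q', hq'⟩ := h
      exact ⟨q', fun _ => hq'⟩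
    -- Off the domain the value of `Φ` is arbitrary.
    · exact ⟨p, fun h' => absurd h' h⟩
  choose Φ hΦ using hex
  have hΦ' : ∀ q q', Step Λ U q q' → q' = Φ q := fun q q' h => hs q _ _ h (hΦ q ⟨q', h⟩)
  have hsm : ∀ f : adOrbit ζ × LieDual E → ℝ, OrbitSmoothOn (LieDual E) f Set.univ →
      OrbitSmoothOn (LieDual E) (fun p => f (Φ p)) {p | ∃ p', Step Λ U p p'} := by
    intro f hf
    rintro ⟨g, m⟩ ⟨p', hp⟩
    obtain ⟨g', hgU, rfl, hp'⟩ := (step_toOrbit_iff hL hΛ U g m p').1 hp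
    refine ContMDiffAt.contMDiffWithinAt ?_
    rw [contMDiffAt_prod_rightParam_comp, neg_lieDeriv₁_eq hL]
    have hF := contDiffAt_lagrangianChart hL g g'
    obtain ⟨σ, hσ, hσ0, hr, -⟩ := exists_smooth_localInverse (contDiffAt_momentumChart hF)
      (bijective_fderiv_charts hL hΛ hU hgU).2
    set B := momentumChart G (lagrangianChart (E := E) L g g') with hB
    set A := legendreChart G (lagrangianChart (E := E) L g g') with hA
    have hB0 : B (origin E G, origin E G) = (origin E G, (B (origin E G, origin E G)).2) := rfl
    rw [← hB0]
    have hAs : ContDiffAt ℝ ∞ A (σ (B (origin E G, origin E G))) := by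
      rw [hσ0]; exact contDiffAt_legendreChart hF
    have hfs : ContDiffAt ℝ ∞ (fun p : E × (E →L[ℝ] ℝ) => f (toOrbit ζ (rightParam g' p.1), p.2))
        (A (σ (B (origin E G, origin E G)))) := by
      rw [hσ0]
      exact OrbitSmoothOn.contDiffAt hf orbitOpen_univ trivial
    have hcomp := ContDiffAt.comp (B (origin E G, origin E G)) (f := A ∘ σ)
      (g := fun p : E × (E →L[ℝ] ℝ) => f (toOrbit ζ (rightParam g' p.1), p.2)) hfs
      (hAs.comp _ hσ)
    refine hcomp.congr_of_eventuallyEq ?_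
    have ht := hσ.continuousAt.tendsto
    rw [hσ0] at ht
    filter_upwards [hr, ht.eventually (eventually_step hL hΛ hU.1 hgU)] with q hq1 hq2
    have h1 := hΦ' _ _ hq2
    rw [← hB, hq1, ← hA] at h1
    change f (Φ _) = f _
    rw [← h1]
    rfl
  refine ⟨Φ, fun p p' => ⟨fun h => ⟨⟨p', h⟩, hΦ' p p' h⟩, ?_⟩, hsm, ?_⟩
  · rintro ⟨h, rfl⟩
    exact hΦ p h
  · intro f₁ f₂ hf₁ hf₂ p hp
    exact (poissonBracket_eq_of_step hL hΛ hU (hΦ p hp) (orbitOpen_step_domain hL hΛ hU)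
      orbitOpen_univ hp trivial (hsm f₁ hf₁) (hsm f₂ hf₂) hf₁ hf₂
      (fun q q' hq => by rw [← hΦ' q q' hq]) (fun q q' hq => by rw [← hΦ' q q' hq])).symm

end StepMaps

/-! ### Conservation of `⟨m, a⟩` and the Casimir property. -/

section Casimir

variable {E : Type*} [NormedAddCommGroup E] [NormedSpace ℝ E] [FiniteDimensional ℝ E]
  {G : Type*} [TopologicalSpace G] [ChartedSpace E G] [Group G] [LieGroup 𝓘(ℝ, E) ∞ G]
  {ζ : Lie E G} {Λ : adOrbit ζ × G → ℝ}

theorem coad_apply_self (a : adOrbit ζ) (ν : orbitTangent a →ₗ[ℝ] ℝ) :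
    coad a ν (a : Lie E G) = 0 := by
  have h : (adMap (a : Lie E G)).rangeRestrict (a : Lie E G) = 0 :=
    Subtype.ext (lie_self (a : Lie E G))
  exact (congrArg ν h).trans (map_zero ν)

theorem MomentumEquation.apply_adAct {a : adOrbit ζ} {w : G} {m m' : LieDual E}
    (h : MomentumEquation Λ a w m m') : m' (adAct w a : Lie E G) = m (a : Lie E G) := by
  have h1 := congrArg (fun T : E →L[ℝ] ℝ => T a.1) h
  have h2 : m' (adAct w a : Lie E G) =
    m a.1 - coad a (orbitGradient (fun b => Λ (b, w)) a) (a : Lie E G) := h1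
  rw [h2, coad_apply_self, sub_zero]

theorem orbitSmoothOn_pairing :
    OrbitSmoothOn (LieDual E) (fun p : adOrbit ζ × LieDual E => p.2 (p.1 : Lie E G))
      Set.univ := by
  refine ContMDiff.contMDiffOn ?_
  have h1 : ContMDiff (𝓘(ℝ, E).prod 𝓘(ℝ, E →L[ℝ] ℝ)) 𝓘(ℝ, E) ∞
      (fun q : G × (E →L[ℝ] ℝ) => adOp E q.1 ζ) := (contMDiff_adOp_apply (E := E) (G := G) ζ).comp contMDiff_fst
  have h2 : ContMDiff (𝓘(ℝ, E).prod 𝓘(ℝ, E →L[ℝ] ℝ)) 𝓘(ℝ, E →L[ℝ] ℝ) ∞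
      (fun q : G × (E →L[ℝ] ℝ) => q.2) := contMDiff_snd
  exact h2.clm_apply h1

/-- Here `∇_m c = a` and `ad* a · ∇_a c = m ∘ ad a`. With `ξ = ∇_m f` the bracket is `m [a, ξ] -
⟨∇_a f, [a, a]⟩ - m [a, ξ]`. -/
theorem isCasimir_pairing :
    IsCasimir (fun p : adOrbit ζ × LieDual E => p.2 (p.1 : Lie E G)) := by
  refine ⟨orbitSmoothOn_pairing, fun f hf p => ?_⟩
  obtain ⟨a, m⟩ := p
  obtain ⟨g, rfl⟩ := exists_toOrbit_eq a
  set v : E := (toOrbit ζ g : Lie E G) with hv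
  have hdual : dualGradient (fun μ : LieDual E => μ v) m = v := by
    refine (SeparatingDual.eq_iff_forall_dual_eq (R := ℝ)).2 fun μ => ?_
    rw [apply_dualGradient]
    exact congrArg (fun T : (E →L[ℝ] ℝ) →L[ℝ] ℝ => T μ)
      ((ContinuousLinearMap.apply ℝ ℝ v).hasFDerivAt (x := m)).fderiv
  have hcoad : ∀ η : E, coad (toOrbit ζ g)
      (orbitGradient (fun a : adOrbit ζ => m (a : Lie E G)) (toOrbit ζ g)) η = m (lieBr G v η) := by
    intro η
    have h1 := ((contDiffAt_adOp_symm (E := E) (G := G)).clm_apply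
      (contDiffAt_const (c := v))).differentiableAt (by simp)
    have h2 := m.hasFDerivAt.comp (origin E G) h1.hasFDerivAt
    have he : (fun x : E => m ((toOrbit ζ (rightParam g x) : adOrbit ζ) : Lie E G)) =
        m ∘ fun x : E => adOp E ((extChartAt 𝓘(ℝ, E) (1 : G)).symm x) v :=
      funext fun x => congrArg m (adOp_rightParam g x ζ)
    rw [← he] at h2
    rw [coad_orbitGradient (fun a : adOrbit ζ => m (a : Lie E G)) g h2.differentiableAt, h2.fderiv,
      ContinuousLinearMap.comp_apply, hasFDerivAt_adOp_symm_apply, ← map_neg, neg_lieBr]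
  have hP : poissonBracket (fun p : adOrbit ζ × LieDual E => p.2 (p.1 : Lie E G)) f
      (toOrbit ζ g, m) =
      coad (toOrbit ζ g) (orbitGradient (fun a : adOrbit ζ => m (a : Lie E G)) (toOrbit ζ g))
        (dualGradient (fun μ => f (toOrbit ζ g, μ)) m)
      - coad (toOrbit ζ g) (orbitGradient (fun a => f (a, m)) (toOrbit ζ g))
        (dualGradient (fun μ : LieDual E => μ v) m)
      - m (lieBr G (dualGradient (fun μ : LieDual E => μ v) m)
        (dualGradient (fun μ => f (toOrbit ζ g, μ)) m)) := rfl
  have h0 : coad (toOrbit ζ g) (orbitGradient (fun a => f (a, m)) (toOrbit ζ g)) v = 0 :=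
    coad_apply_self _ _
  rw [hP, hcoad, hdual, h0]
  ring

end Casimir

end DiscreteLagrange

end

open DiscreteLagrange in
theorem proposition3p7
    {E : Type*} [NormedAddCommGroup E] [NormedSpace ℝ E] [FiniteDimensional ℝ E]
    {G : Type*} [TopologicalSpace G] [T2Space G] [ChartedSpace E G] [Group G]
    [LieGroup 𝓘(ℝ, E) ∞ G]
    (ζ : Lie E G) (L : G → G → ℝ)
    (hL : ContMDiff (𝓘(ℝ, E).prod 𝓘(ℝ, E)) 𝓘(ℝ, ℝ) ∞ (fun q : G × G => L q.1 q.2))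
    (hinv : ∀ g w : G, ∀ h ∈ isotropy ζ,
      rightTrivialization L (g * h) w = rightTrivialization L g w)
    (Λ : adOrbit ζ × G → ℝ) (hΛ : Λ = reducedLagrangian ζ (rightTrivialization L)) :
    -- the reduced Lagrange function is well defined, and so are gradients on the orbit
    (∀ g w : G, Λ (toOrbit ζ g, w) = rightTrivialization L g w) ∧
    (∀ (f : adOrbit ζ → ℝ) (a : adOrbit ζ),
      MDifferentiableAt 𝓘(ℝ, E) 𝓘(ℝ, ℝ) (fun h : G => f (adAct h a)) 1 →
        ∃! ν, HasOrbitGradient f a ν) ∧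
    -- the reduced equations are the Euler-Lagrange equations of the reduction `(g, w) ↦ (a, w)`
    (∀ (k₀ k₁ : ℤ) (g : ℤ → G), IsExtremal (E := E) L k₀ k₁ g ↔
      SolvesReduced Λ k₀ k₁ (fun k => toOrbit ζ (g k)) (fun k => g (k + 1) * (g k)⁻¹)) ∧
    (∀ (k₀ k₁ : ℤ) (a : ℤ → adOrbit ζ) (w : ℤ → G), SolvesReduced Λ k₀ k₁ a w →
      ∃ g : ℤ → G, IsExtremal (E := E) L k₀ k₁ g ∧
        (∀ k, k₀ ≤ k → k ≤ k₁ → a k = toOrbit ζ (g k)) ∧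
        ∀ k, k₀ ≤ k → k < k₁ → g (k + 1) = w k * g k) ∧
    -- the Poisson property, if the Legendre transformation is invertible (on `U`)
    (∀ U : Set (adOrbit ζ × G), LegendreInvertibleOn Λ U →
      -- the equations define the map `(a_{k+1}, m_{k+1}) ↦ (a_k, m_k)`, and it is Poisson
      (∃ Ψ : adOrbit ζ × LieDual E → adOrbit ζ × LieDual E,
        (∀ p p', Step Λ U p p' ↔ p' ∈ legendre Λ '' U ∧ p = Ψ p') ∧
        IsPoissonMapOn Ψ (legendre Λ '' U)) ∧
      -- the correspondence `(a_k, m_k) ↦ (a_{k+1}, m_{k+1})` is locally a map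
      (∀ p p', Step Λ U p p' → ∃ V ⊆ U, LegendreInvertibleOn Λ V ∧ Step Λ V p p' ∧
        ∀ q q' q'', Step Λ V q q' → Step Λ V q q'' → q' = q'') ∧
      -- where it is single-valued it is a Poisson map with an open domain
      ((∀ q q' q'', Step Λ U q q' → Step Λ U q q'' → q' = q'') →
        OrbitOpen {p | ∃ p', Step Λ U p p'} ∧
        ∃ Φ : adOrbit ζ × LieDual E → adOrbit ζ × LieDual E,
          (∀ p p', Step Λ U p p' ↔ (∃ q', Step Λ U p q') ∧ p' = Φ p) ∧
          IsPoissonMapOn Φ {p | ∃ p', Step Λ U p p'})) ∧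
    -- the integral of motion and Casimir `⟨m, a⟩`
    (∀ (k₀ k₁ : ℤ) (a : ℤ → adOrbit ζ) (w : ℤ → G), SolvesReduced Λ k₀ k₁ a w →
      ∀ k, k₀ < k → k < k₁ →
        momentum Λ a w (k + 1) (a (k + 1) : Lie E G) = momentum Λ a w k (a k : Lie E G)) ∧
    (∀ p p', Step Λ Set.univ p p' → p'.2 (p'.1 : Lie E G) = p.2 (p.1 : Lie E G)) ∧
    IsCasimir (fun p : adOrbit ζ × LieDual E => p.2 (p.1 : Lie E G)) := by
  -- This identity is all that the other parts use about `Λ`; the chosen representatives play no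
  -- further role.
  have hred : ∀ g w : G, Λ (toOrbit ζ g, w) = rightTrivialization L g w := by
    subst hΛ; exact reducedLagrangian_toOrbit hinv
  refine ⟨hred, existsUnique_hasOrbitGradient, isExtremal_iff_solvesReduced hL hred,
    exists_extremal_of_solvesReduced hL hred, fun U hU => ⟨exists_backward_map hL hred hU,
      fun p p' hp => exists_singleValued_subset hL hred hU hp,
      fun hs => ⟨orbitOpen_step_domain hL hred hU, exists_forward_map hL hred hU hs⟩⟩, ?_, ?_,
    isCasimir_pairing⟩
  · intro k₀ k₁ a w h k hk₀ hk₁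
    rw [h.2 k hk₀.le hk₁]
    exact (h.1 k hk₀ hk₁).apply_adAct
  · rintro p p' ⟨w, -, rfl, hm⟩
    exact hm.apply_adAct
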